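/- Consider the uplink of $L$ cells with $K$ single-antenna users each and a base station (BS) with $M\ge K$ antennas in cell $\ell$. Let $P_{\mathrm u}>0$ be the transmit power of each user, let $\beta_{i\ell,k}\ge 0$ be the large-scale fading from user $k$ of cell $i$ to this BS, with $\beta_{\ell\ell,k'}>0$ for all $k'$, and let $\mathbf G_{i}=\mathbf H_{i}\,\mathrm{diag}(\beta_{i\ell,1},\dots,\beta_{i\ell,K})^{1/2}$, where $\mathbf H_i$ is $M\times K$. All cells send the same pilots $\sqrt{\tau P_{\mathrm u}}\,\mathbf\Psi$, where $\mathbf\Psi$ is $\tau\times K$ with $\mathbf\Psi^\dagger\mathbf\Psi=\mathbf I_K$, and the BS receives $\mathbf Y=\sqrt{\tau P_{\mathrm u}}\sum_{i}\mathbf G_i\mathbf\Psi^T+\mathbf N$. The entries of all $\mathbf H_i$, of $\mathbf N$ and of the data-phase noise $\mathbf n$ are i.i.d. $\mathcal{CN}(0,1)$, and the family of data vectors $(\mathbf x_i)_i$ is independent of them, with $\mathbb E[\mathbf x_i\mathbf x_i^\dagger]=\mathbf I_K$ for every $i$. Let $\hat{\mathbf G}_i$ be the MMSE estimate of $\mathbf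 G_i$, i.e. the matrix whose $k$-th column is $\frac{\sqrt{\tau P_{\mathrm u}}\,\beta_{i\ell,k}}{\tau P_{\mathrm u}\sum_j\beta_{j\ell,k}+1}$ times the $k$-th column of $\mathbf Y\mathbf\Psi^*$. Let $\xi_i=\mathbf G_i-\hat{\mathbf G}_i$, $\mathbf A=\hat{\mathbf G}_\ell(\hat{\mathbf G}_\ell^\dagger\hat{\mathbf G}_\ell)^{-1}$ (the zero-forcing receiver), and let $\mathbf a_k$ be the $k$-th column of $\mathbf A$. Fix a user $k$ of cell $\ell$ with $\beta_{i\ell,k}>0$ for at least one $i\ne\ell$. The SINR of this user is $$\gamma=\Bigl(\mathbb E\bigl[|\mathbf a_k^\dagger\xi_\ell\mathbf x_\ell|^2\,\big|\,\hat{\mathbf G}_\ell\bigr]+\mathbb E\Bigl[\sum_{i\ne\ell}|\mathbf a_k^\dagger\mathbf G_i\mathbf x_i|^2\,\Big|\,\hat{\mathbf G}_\ell\Bigr]+\mathbb E\bigl[|\mathbf a_k^\dagger\mathbf n|^2/P_{\mathrm u}\,\big|\,\hat{\mathbf G}_\ell\bigr]\Bigr)^{-1}.$$ Put $\hat\beta=\sum_j\beta_{j\ell,k}+\frac1{\tau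 P_{\mathrm u}}$, $$\alpha_i=\sum_{k'=1}^K\frac{\beta_{i\ell,k'}\bigl(\tau P_{\mathrm u}\sum_{j\ne i}\beta_{j\ell,k'}+1\bigr)}{\tau P_{\mathrm u}\sum_j\beta_{j\ell,k'}+1},\qquad a=\frac{\sum_{i}\beta_{i\ell,k}^2}{\hat\beta\,\bigl(\sum_i\alpha_i+1/P_{\mathrm u}\bigr)},\qquad b=\frac{\sum_{i\ne\ell}\beta_{i\ell,k}^2}{\hat\beta\,\bigl(\sum_i\alpha_i+1/P_{\mathrm u}\bigr)},$$ and $\mathrm{Ei}(z)=-\int_{-z}^\infty\frac{e^{-t}}t\,dt$ for $z<0$. Then: (1) $\mathbb E[\xi_i\xi_i^\dagger]=\alpha_i\mathbf I_M$ for every cell $i$. (2) $\log_2(1+\gamma)$ is integrable, and with $\nu=M-K$ $$\mathbb E[\log_2(1+\gamma)]=\sum_{\mu=0}^{\nu}\frac{\log_2 e}{(\nu-\mu)!}\Bigl[(-1)^{\nu-\mu-1}\Bigl(\frac{e^{1/a}}{a^{\nu-\mu}}\mathrm{Ei}\bigl(-\tfrac1a\bigr)-\frac{e^{1/b}}{b^{\nu-\mu}}\mathrm{Ei}\bigl(-\tfrac1b\bigr)\Bigr)+\sum_{q=1}^{\nu-\mu}(q-1)!\Bigl(\bigl(-\tfrac1a\bigr)^{\nu-\mu-q}-\bigl(-\tfrac1b\bigr)^{\nu-\mu-q}\Bigr)\Bigr].$$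 (3) Let $\tilde\alpha_i=\sum_{k'}\frac{\tau P_{\mathrm u}\beta_{i\ell,k'}\sum_{j\ne i}\beta_{j\ell,k'}}{\tau P_{\mathrm u}\sum_j\beta_{j\ell,k'}+1}$, which is $\alpha_i$ without the contribution of the training noise, and let $$\tilde\gamma=\Bigl(\bigl(\textstyle\sum_i\tilde\alpha_i+1/P_{\mathrm u}\bigr)\bigl[(\hat{\mathbf G}_\ell^\dagger\hat{\mathbf G}_\ell)^{-1}\bigr]_{kk}+\sum_{i\ne\ell}\beta_{i\ell,k}^2/\beta_{\ell\ell,k}^2\Bigr)^{-1}.$$ Then $\log_2(1+\tilde\gamma)$ is integrable, and the formula of (2) holds for $\mathbb E[\log_2(1+\tilde\gamma)]$ when $\tilde\alpha_i$ replaces $\alpha_i$ in $a$ and $b$. -/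

import Mathlib

open MeasureTheory ProbabilityTheory Matrix
open scoped ENNReal ComplexConjugate

noncomputable section

/-- The circularly symmetric complex Gaussian law `CN(0, 1)`: independent real and imaginary parts,
each with law `N(0, 1/2)`. -/
def stdComplexGaussian : Measure ℂ :=
  ((gaussianReal 0 (1 / 2)).prod (gaussianReal 0 (1 / 2))).map
    (fun p : ℝ × ℝ => (⟨p.1, p.2⟩ : ℂ))

/-- The exponential integral `Ei z = -∫_{-z}^∞ e^{-t} / t dt` (used only for `z < 0`). -/
def expInt (z : ℝ) : ℝ :=
  -∫ t in Set.Ioi (-z), Real.exp (-t) / t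

/-- The quantities seen by the base station (BS) of one cell `ℓ`: there are `L` cells with `K` users
each, the BS has `M` antennas and `τ` pilot symbols are used. -/
structure Uplink (L K M τ : ℕ) (Ω : Type*) where
  /-- the cell whose BS is considered -/
  ℓ : Fin L
  /-- average transmit power of each user -/
  P : ℝ
  /-- `β i k`: large-scale fading from user `k` of cell `i` to the BS of cell `ℓ` -/
  β : Fin L → Fin K → ℝ
  /-- pilot matrix, the same in all cells (transmitted with the factor `√(τ P)`) -/
  Ψ : Matrix (Fin τ) (Fin K) ℂ
  /-- `H i`: fast fading from the users of cell `i` to the BS of cell `ℓ` -/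
  H : Fin L → Ω → Matrix (Fin M) (Fin K) ℂ
  /-- receiver noise during the training phase -/
  N : Ω → Matrix (Fin M) (Fin τ) ℂ
  /-- `x i`: data symbols of the users of cell `i` -/
  x : Fin L → Ω → Fin K → ℂ
  /-- receiver noise during the data phase -/
  n : Ω → Fin M → ℂ

namespace Uplink

variable {L K M τ : ℕ} {Ω : Type*} (S : Uplink L K M τ Ω)

/-- All fast-fading and noise coefficients, as one family. -/
def gaussians : (Fin L × Fin M × Fin K) ⊕ (Fin M × Fin τ) ⊕ Fin M → Ω → ℂ
  | .inl (i, m, k) => fun ω => S.H i ω m k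
  | .inr (.inl (m, t)) => fun ω => S.N ω m t
  | .inr (.inr m) => fun ω => S.n ω m

/-- The system model: positive power, orthonormal pilots, i.i.d. `CN(0, 1)` fading and noise
coefficients, and data symbols that are independent of these and satisfy `E[x xᴴ] = I` in each
cell. -/
structure IsModel [MeasurableSpace Ω] (μ : Measure Ω) : Prop where
  P_pos : 0 < S.P
  pilots : S.Ψᴴ * S.Ψ = 1
  measurable_gaussians : ∀ j, Measurable (S.gaussians j)
  law_gaussians : ∀ j, μ.map (S.gaussians j) = stdComplexGaussian
  indep_gaussians : iIndepFun S.gaussians μ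
  measurable_x : ∀ i k, Measurable (fun ω => S.x i ω k)
  memLp_x : ∀ i k, MemLp (fun ω => S.x i ω k) 2 μ
  cov_x : ∀ i k k', ∫ ω, S.x i ω k * conj (S.x i ω k') ∂μ = if k = k' then 1 else 0
  indep_x : IndepFun (fun ω i k => S.x i ω k) (fun ω j => S.gaussians j ω) μ

/-- Channel matrix `G_i = H_i D_i^{1/2}` from the users of cell `i`. -/
def G (i : Fin L) (ω : Ω) : Matrix (Fin M) (Fin K) ℂ :=
  S.H i ω * Matrix.diagonal (fun k => ((√(S.β i k) : ℝ) : ℂ))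

/-- Received pilot matrix. -/
def Yp (ω : Ω) : Matrix (Fin M) (Fin τ) ℂ :=
  ((√(τ * S.P) : ℝ) : ℂ) • (∑ i, S.G i ω * S.Ψᵀ) + S.N ω

/-- Received pilot matrix projected onto the conjugate pilots. -/
def Ypt (ω : Ω) : Matrix (Fin M) (Fin K) ℂ :=
  S.Yp ω * S.Ψ.map conj

/-- MMSE estimate of `H_i`. -/
def Hhat (i : Fin L) (ω : Ω) : Matrix (Fin M) (Fin K) ℂ :=
  Matrix.of fun m k =>
    ((√(τ * S.P * S.β i k) * (τ * S.P * ∑ j, S.β j k + 1)⁻¹ : ℝ) : ℂ) * S.Ypt ω m k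

/-- MMSE estimate of `G_i`. -/
def Ghat (i : Fin L) (ω : Ω) : Matrix (Fin M) (Fin K) ℂ :=
  S.Hhat i ω * Matrix.diagonal (fun k => ((√(S.β i k) : ℝ) : ℂ))

/-- Channel estimation error `ξ_i = G_i - Ĝ_i`. -/
def err (i : Fin L) (ω : Ω) : Matrix (Fin M) (Fin K) ℂ :=
  S.G i ω - S.Ghat i ω

/-- Zero-forcing receiver `A = Ĝ (Ĝᴴ Ĝ)⁻¹`, with `Ĝ` the estimate of the channel of cell `ℓ`. -/
def zf (ω : Ω) : Matrix (Fin M) (Fin K) ℂ :=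
  S.Ghat S.ℓ ω * ((S.Ghat S.ℓ ω)ᴴ * S.Ghat S.ℓ ω)⁻¹

/-- The σ-algebra generated by the estimate `Ĝ` of the channel of cell `ℓ`, i.e. the information
that determines the receiver. -/
@[reducible] def csi : MeasurableSpace Ω :=
  MeasurableSpace.comap (fun ω (m : Fin M) (k : Fin K) => S.Ghat S.ℓ ω m k) inferInstance

/-- Post-processing SINR of user `k` of cell `ℓ`: the reciprocal of the sum of the mean powers of the
estimation-error, inter-cell interference and noise terms at the output of the receiver (relative
to the signal power), the means being taken for the given channel estimate. -/
def sinr [MeasurableSpace Ω] (μ : Measure Ω) (k : Fin K) (ω : Ω) : ℝ :=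
  ((μ⁻[fun ω' => ‖((S.zf ω')ᴴ *ᵥ (S.err S.ℓ ω' *ᵥ S.x S.ℓ ω')) k‖ₑ ^ 2 | S.csi] ω
    + μ⁻[fun ω' => ∑ i ∈ Finset.univ.erase S.ℓ,
        ‖((S.zf ω')ᴴ *ᵥ (S.G i ω' *ᵥ S.x i ω')) k‖ₑ ^ 2 | S.csi] ω
    + μ⁻[fun ω' => ‖((S.zf ω')ᴴ *ᵥ S.n ω') k‖ₑ ^ 2 / ENNReal.ofReal S.P | S.csi] ω)⁻¹).toReal

/-- The SINR in terms of the channel estimate, when the estimation-error powers are `α i`. -/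
def sinrOf (α : Fin L → ℝ) (k : Fin K) (ω : Ω) : ℝ :=
  1 / ((∑ i, α i + 1 / S.P) * (((S.Ghat S.ℓ ω)ᴴ * S.Ghat S.ℓ ω)⁻¹ k k).re
    + (∑ i ∈ Finset.univ.erase S.ℓ, S.β i k ^ 2) / S.β S.ℓ k ^ 2)

/-- Estimation-error power `α_i` (per antenna, summed over the users) of the MMSE estimator. -/
def errPower (i : Fin L) : ℝ :=
  ∑ k, S.β i k * (τ * S.P * ∑ j ∈ Finset.univ.erase i, S.β j k + 1) /
    (τ * S.P * ∑ j, S.β j k + 1)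

/-- The part of `errPower` that is due to pilot contamination alone. -/
def contamPower (i : Fin L) : ℝ :=
  ∑ k, τ * S.P * S.β i k * (∑ j ∈ Finset.univ.erase i, S.β j k) /
    (τ * S.P * ∑ j, S.β j k + 1)

/-- `β̂_k = ∑_j β_{j,k} + 1 / (τ P)`. -/
def betaHat (k : Fin K) : ℝ := ∑ j, S.β j k + 1 / (τ * S.P)

/-- The parameter `a`. -/
def aCoef (α : Fin L → ℝ) (k : Fin K) : ℝ :=
  (∑ i, S.β i k ^ 2) / (S.betaHat k * (∑ i, α i + 1 / S.P))

/-- The parameter `b`. -/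
def bCoef (α : Fin L → ℝ) (k : Fin K) : ℝ :=
  (∑ i ∈ Finset.univ.erase S.ℓ, S.β i k ^ 2) / (S.betaHat k * (∑ i, α i + 1 / S.P))

end Uplink

/-- The closed form of the rate, with `ν = M - K`. -/
def rateClosedForm (ν : ℕ) (a b : ℝ) : ℝ :=
  ∑ p ∈ Finset.range (ν + 1), Real.logb 2 (Real.exp 1) / ((ν - p).factorial : ℝ) *
    ((-1 : ℝ) ^ ((ν : ℤ) - p - 1) *
        (1 / a ^ (ν - p) * Real.exp (1 / a) * expInt (-(1 / a))
          - 1 / b ^ (ν - p) * Real.exp (1 / b) * expInt (-(1 / b)))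
      + ∑ q ∈ Finset.Icc 1 (ν - p), ((q - 1).factorial : ℝ) *
          ((-(1 / a)) ^ (ν - p - q) - (-(1 / b)) ^ (ν - p - q)))

end

/-! All fading and noise coefficients form one vector `z` with i.i.d. `CN(0, 1)` entries, and the
projected pilots, the channels, the estimation errors and the data-phase noise are linear images of
`z`. Covariances of such images are matrix products `A * Bᴴ`, and images with `A * Bᴴ = 0` are
independent (`indepFun_mulVec_stdComplexGaussianPi`). The MMSE coefficient is the one that makes
error and pilots uncorrelated (`errMat_mul_conjTranspose_pilotMat`). This yields claim (1), and the
independence of the error from the channel estimate.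

Since the pilots are reused, the estimate of every cell is the matrix `Ĝ_ℓ` with rescaled columns
(`Ghat_eq_mul_diagonal`). Zero forcing therefore leaves from cell `i` the scalar `β_i/β_ℓ` times the
symbol of user `k`, plus a filtered error. Put `q = [(Ĝ_ℓᴴ Ĝ_ℓ)⁻¹]_kk = ‖a_k‖²`. Given the estimate,
the own error has power `α_ℓ q`, cell `i ≠ ℓ` contributes `(β_i/β_ℓ)² + α_i q`, and the noise `q/P`;
hence `sinr_ae_eq`.

Only `q` is random now. Up to column scales, `Ĝ_ℓ` is a matrix `Z` of i.i.d. `CN(0, 1)` entries, and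
`1/[(Zᴴ Z)⁻¹]_kk` is the squared distance of column `k` to the span of the other columns
(`gram_inv_apply_re_mul`). These are independent of column `k` and span dimension `K - 1`, so the
distance has the law of the squared norm of a Gaussian vector in dimension `M - K + 1`: Erlang
(`map_inv_gram_inv`). With `X` this variable, `1 + γ = (1 + a X)/(1 + b X)`, and the rate is a
difference of two integrals `E[log(1 + c X)]`, evaluated by parts
(`integral_logb_div_erlangMeasure`).

The last step works for any nonnegative error powers (`integral_logb_sinrOf`), so it gives both (2)
and (3). -/

noncomputable section

/-! ### Linear images of i.i.d. complex Gaussian vectors -/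

section ComplexGaussian

open WithLp

lemma measurable_complex_mk : Measurable (fun p : ℝ × ℝ => (⟨p.1, p.2⟩ : ℂ)) :=
  Complex.measurableEquivRealProd.symm.measurable

instance isProbabilityMeasure_stdComplexGaussian : IsProbabilityMeasure stdComplexGaussian :=
  Measure.isProbabilityMeasure_map measurable_complex_mk.aemeasurable

lemma charFun_stdComplexGaussian (t : ℂ) :
    charFun stdComplexGaussian t = Complex.exp (-((‖t‖ ^ 2 / 4 : ℝ) : ℂ)) := by
  rw [charFun_apply, stdComplexGaussian, integral_map measurable_complex_mk.aemeasurable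
    (by fun_prop)]
  have h : ∀ p : ℝ × ℝ, Complex.exp ((inner ℝ (⟨p.1, p.2⟩ : ℂ) t : ℝ) * Complex.I)
      = Complex.exp (t.re * p.1 * Complex.I) * Complex.exp (t.im * p.2 * Complex.I) := by
    intro p
    rw [← Complex.exp_add, Complex.inner]
    congr 1
    simp
    ring
  simp_rw [h]
  rw [integral_prod_mul (fun x : ℝ => Complex.exp (t.re * x * Complex.I))
    (fun x : ℝ => Complex.exp (t.im * x * Complex.I)), ← charFun_apply_real,
    ← charFun_apply_real, charFun_gaussianReal, charFun_gaussianReal, ← Complex.exp_add,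
    ← Complex.normSq_eq_norm_sq, Complex.normSq_apply]
  congr 1
  push_cast
  simp
  ring

variable {I I' J : Type*} [Fintype I] [Fintype I'] [Fintype J]

/-- The law of a vector of i.i.d. `CN(0, 1)` coordinates. -/
abbrev stdComplexGaussianPi (J : Type*) [Fintype J] : Measure (J → ℂ) :=
  Measure.pi fun _ => stdComplexGaussian

/-- Characteristic functions on `ℂ^J` use the real inner product, the real part of the Hermitian
one, so the adjoint has to be moved across in this form. -/
lemma inner_mulVec_toLp (A : Matrix I J ℂ) (z : J → ℂ) (t : PiLp 2 fun _ : I => ℂ) :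
    inner ℝ (toLp 2 (A *ᵥ z) : PiLp 2 fun _ : I => ℂ) t
      = inner ℝ (toLp 2 z : PiLp 2 fun _ : J => ℂ) (toLp 2 (Aᴴ *ᵥ ofLp t)) := by
  simp only [PiLp.inner_apply, Complex.inner, ← Complex.re_sum]
  congr 1
  simp only [mulVec, dotProduct, Finset.sum_mul, map_sum, map_mul, Finset.mul_sum,
    conjTranspose_apply, RCLike.star_def]
  rw [Finset.sum_comm]
  refine Finset.sum_congr rfl fun i _ => Finset.sum_congr rfl fun j _ => ?_
  ring

lemma charFun_map_mulVec (A : Matrix I J ℂ) (t : PiLp 2 fun _ : I => ℂ) :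
    charFun (((stdComplexGaussianPi J).map (A *ᵥ ·)).map (toLp 2)) t
      = Complex.exp (-((∑ j, ‖(Aᴴ *ᵥ ofLp t) j‖ ^ 2 / 4 : ℝ) : ℂ)) := by
  have hm : Measurable (fun z : J → ℂ => A *ᵥ z) := by fun_prop
  rw [charFun_apply, integral_map (by fun_prop) (by fun_prop),
    integral_map (by fun_prop) (by fun_prop)]
  have := charFun_pi (μ := fun _ : J => stdComplexGaussian) (toLp 2 (Aᴴ *ᵥ ofLp t))
  rw [charFun_apply, integral_map (by fun_prop) (by fun_prop)] at this
  simp_rw [inner_mulVec_toLp]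
  rw [this]
  simp only [charFun_stdComplexGaussian, ← Complex.exp_sum]
  congr 1
  push_cast
  simp

lemma sum_norm_sq_eq_dotProduct (v : J → ℂ) : ((∑ j, ‖v j‖ ^ 2 : ℝ) : ℂ) = star v ⬝ᵥ v := by
  simp only [dotProduct, Pi.star_apply, RCLike.star_def, ← Complex.normSq_eq_conj_mul_self,
    Complex.normSq_eq_norm_sq]
  push_cast
  rfl

lemma sum_norm_sq_conjTranspose_mulVec (A : Matrix I J ℂ) (t : I → ℂ) :
    ((∑ j, ‖(Aᴴ *ᵥ t) j‖ ^ 2 : ℝ) : ℂ) = star t ⬝ᵥ ((A * Aᴴ) *ᵥ t) := by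
  rw [sum_norm_sq_eq_dotProduct, star_mulVec, conjTranspose_conjTranspose, ← dotProduct_mulVec,
    mulVec_mulVec]

/-- Orthonormal linear combinations of i.i.d. `CN(0, 1)` variables are i.i.d. `CN(0, 1)`. -/
theorem map_mulVec_stdComplexGaussianPi [DecidableEq I] (A : Matrix I J ℂ) (hA : A * Aᴴ = 1) :
    (stdComplexGaussianPi J).map (A *ᵥ ·) = stdComplexGaussianPi I := by
  have hm : Measurable (fun z : J → ℂ => A *ᵥ z) := by fun_prop
  have := Measure.isProbabilityMeasure_map (μ := stdComplexGaussianPi J) hm.aemeasurable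
  refine charFun_eq_pi_iff.1 fun t => ?_
  rw [charFun_map_mulVec]
  simp only [charFun_stdComplexGaussian, ← Complex.exp_sum]
  congr 1
  have := sum_norm_sq_conjTranspose_mulVec A (ofLp t)
  rw [hA, one_mulVec, ← sum_norm_sq_eq_dotProduct] at this
  rw [← Finset.sum_div, Complex.ofReal_div, this]
  push_cast
  rw [Finset.sum_neg_distrib, Finset.sum_div]

/-- Uncorrelated linear combinations of i.i.d. `CN(0, 1)` variables are independent. -/
theorem indepFun_mulVec_stdComplexGaussianPi (A : Matrix I J ℂ) (B : Matrix I' J ℂ)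
    (hAB : A * Bᴴ = 0) :
    IndepFun (A *ᵥ ·) (B *ᵥ ·) (stdComplexGaussianPi J) := by
  classical
  have hA : Measurable (fun z : J → ℂ => A *ᵥ z) := by fun_prop
  have hB : Measurable (fun z : J → ℂ => B *ᵥ z) := by fun_prop
  have hA' : Measurable (fun z : J → ℂ => (toLp 2 (A *ᵥ z) : PiLp 2 fun _ : I => ℂ)) := by fun_prop
  have hB' : Measurable (fun z : J → ℂ => (toLp 2 (B *ᵥ z) : PiLp 2 fun _ : I' => ℂ)) := by fun_prop
  have key : IndepFun (fun z : J → ℂ => (toLp 2 (A *ᵥ z) : PiLp 2 fun _ : I => ℂ))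
      (fun z : J → ℂ => (toLp 2 (B *ᵥ z) : PiLp 2 fun _ : I' => ℂ)) (stdComplexGaussianPi J) := by
    rw [indepFun_iff_charFun_prod hA'.aemeasurable hB'.aemeasurable]
    intro t
    have h1 := charFun_map_mulVec A (ofLp t).1
    have h2 := charFun_map_mulVec B (ofLp t).2
    rw [Measure.map_map (by fun_prop) hA] at h1
    rw [Measure.map_map (by fun_prop) hB] at h2
    have e1 : (fun z : J → ℂ => (toLp 2 (A *ᵥ z) : PiLp 2 fun _ : I => ℂ))
      = toLp 2 ∘ (A *ᵥ ·) := rfl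
    have e2 : (fun z : J → ℂ => (toLp 2 (B *ᵥ z) : PiLp 2 fun _ : I' => ℂ))
      = toLp 2 ∘ (B *ᵥ ·) := rfl
    rw [e1, e2, h1, h2, charFun_apply, integral_map (by fun_prop) (by fun_prop)]
    have := charFun_pi (μ := fun _ : J => stdComplexGaussian)
      (toLp 2 (Aᴴ *ᵥ ofLp (ofLp t).1 + Bᴴ *ᵥ ofLp (ofLp t).2))
    rw [charFun_apply, integral_map (by fun_prop) (by fun_prop)] at this
    simp only [prod_inner_apply]
    have e3 : ∀ z : J → ℂ, inner ℝ (toLp 2 (A *ᵥ z) : PiLp 2 fun _ : I => ℂ) (ofLp t).1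
        + inner ℝ (toLp 2 (B *ᵥ z) : PiLp 2 fun _ : I' => ℂ) (ofLp t).2
        = inner ℝ (toLp 2 z : PiLp 2 fun _ : J => ℂ)
          (toLp 2 (Aᴴ *ᵥ ofLp (ofLp t).1 + Bᴴ *ᵥ ofLp (ofLp t).2)) := by
      intro z
      rw [inner_mulVec_toLp, inner_mulVec_toLp, toLp_add, inner_add_right]
    simp_rw [e3]
    rw [this]
    simp only [charFun_stdComplexGaussian, ← Complex.exp_sum, ← Complex.exp_add]
    congr 1
    have hBA : B * Aᴴ = 0 := by
      rw [← conjTranspose_conjTranspose B, ← conjTranspose_mul, hAB, conjTranspose_zero]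
    set u := ofLp (ofLp t).1
    set v := ofLp (ofLp t).2
    -- Pythagoras: `A * Bᴴ = 0` removes the cross terms, so the Gaussian exponent splits and the
    -- joint characteristic function factors.
    have hs : (∑ j, ‖(Aᴴ *ᵥ u + Bᴴ *ᵥ v) j‖ ^ 2 : ℝ)
        = ∑ j, ‖(Aᴴ *ᵥ u) j‖ ^ 2 + ∑ j, ‖(Bᴴ *ᵥ v) j‖ ^ 2 := by
      apply Complex.ofReal_injective
      rw [Complex.ofReal_add, sum_norm_sq_eq_dotProduct, sum_norm_sq_eq_dotProduct,
        sum_norm_sq_eq_dotProduct, star_add, add_dotProduct, dotProduct_add, dotProduct_add]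
      have z1 : star (Aᴴ *ᵥ u) ⬝ᵥ (Bᴴ *ᵥ v) = 0 := by
        rw [star_mulVec, conjTranspose_conjTranspose, ← dotProduct_mulVec, mulVec_mulVec, hAB,
          zero_mulVec, dotProduct_zero]
      have z2 : star (Bᴴ *ᵥ v) ⬝ᵥ (Aᴴ *ᵥ u) = 0 := by
        rw [star_mulVec, conjTranspose_conjTranspose, ← dotProduct_mulVec, mulVec_mulVec, hBA,
          zero_mulVec, dotProduct_zero]
      rw [z1, z2]
      ring
    simp only [← Finset.sum_div, ← Complex.ofReal_neg, ← Complex.ofReal_add, ← Complex.ofReal_sum]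
    rw [Finset.sum_neg_distrib, ← Finset.sum_div]
    rw [hs]
    congr 1
    ring
  exact key.comp (φ := ofLp) (ψ := ofLp) (by fun_prop) (by fun_prop)

lemma memLp_id_stdComplexGaussian : MemLp id 2 stdComplexGaussian := by
  rw [stdComplexGaussian, memLp_map_measure_iff (by fun_prop) measurable_complex_mk.aemeasurable]
  have h1 : MemLp (fun p : ℝ × ℝ => (p.1 : ℂ)) 2
      ((gaussianReal 0 (1 / 2)).prod (gaussianReal 0 (1 / 2))) :=
    ((memLp_id_gaussianReal' (μ := 0) (v := 1 / 2) 2 (by simp)).ofReal (K := ℂ)).comp_fst _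
  have h2 : MemLp (fun p : ℝ × ℝ => (p.2 : ℂ)) 2
      ((gaussianReal 0 (1 / 2)).prod (gaussianReal 0 (1 / 2))) :=
    ((memLp_id_gaussianReal' (μ := 0) (v := 1 / 2) 2 (by simp)).ofReal (K := ℂ)).comp_snd _
  convert! h1.add (h2.mul_const Complex.I) using 1
  ext p
  simp [Complex.ext_iff]

lemma integral_id_stdComplexGaussian : ∫ z, z ∂stdComplexGaussian = 0 := by
  rw [stdComplexGaussian, integral_map measurable_complex_mk.aemeasurable (by fun_prop)]
  have h1 : Integrable (fun x : ℝ => (x : ℂ)) (gaussianReal 0 (1 / 2)) :=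
    ((memLp_id_gaussianReal' (μ := 0) (v := 1 / 2) 1 (by simp)).ofReal (K := ℂ)).integrable le_rfl
  have h : ∀ p : ℝ × ℝ, (⟨p.1, p.2⟩ : ℂ) = p.1 + p.2 * Complex.I := fun p => by
    simp [Complex.ext_iff]
  simp_rw [h]
  rw [integral_add (h1.comp_fst _) ((h1.comp_snd _).mul_const _), integral_mul_const,
    integral_fun_fst (fun x : ℝ => (x : ℂ)), integral_fun_snd (fun x : ℝ => (x : ℂ)),
    integral_complex_ofReal, integral_id_gaussianReal]
  simp

lemma integral_mul_conj_stdComplexGaussian : ∫ z, z * conj z ∂stdComplexGaussian = 1 := by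
  rw [stdComplexGaussian, integral_map measurable_complex_mk.aemeasurable (by fun_prop)]
  have h1 : Integrable (fun x : ℝ => x ^ 2) (gaussianReal 0 (1 / 2)) :=
    (memLp_id_gaussianReal' (μ := 0) (v := 1 / 2) 2 (by simp)).integrable_sq
  have h2 : ∫ x, x ^ 2 ∂(gaussianReal 0 (1 / 2)) = 1 / 2 := by
    have := variance_fun_id_gaussianReal (μ := 0) (v := 1 / 2)
    rw [variance_eq_integral measurable_id'.aemeasurable] at this
    simpa [integral_id_gaussianReal] using this
  have h : ∀ p : ℝ × ℝ, (⟨p.1, p.2⟩ : ℂ) * conj (⟨p.1, p.2⟩ : ℂ)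
      = ((p.1 ^ 2 + p.2 ^ 2 : ℝ) : ℂ) := fun p => by
    rw [Complex.mul_conj, Complex.normSq_mk]
    ring_nf
  simp_rw [h]
  rw [integral_complex_ofReal, integral_add (h1.comp_fst _) (h1.comp_snd _),
    integral_fun_fst (fun x : ℝ => x ^ 2), integral_fun_snd (fun x : ℝ => x ^ 2), h2]
  norm_num

lemma memLp_eval_stdComplexGaussianPi (j : J) :
    MemLp (fun z : J → ℂ => z j) 2 (stdComplexGaussianPi J) :=
  memLp_id_stdComplexGaussian.comp_measurePreserving (measurePreserving_eval _ j)

lemma integral_eval_stdComplexGaussianPi (j : J) : ∫ z, z j ∂(stdComplexGaussianPi J) = 0 := by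
  rw [← integral_id_stdComplexGaussian]
  exact (integral_map (μ := stdComplexGaussianPi J) (φ := Function.eval j)
    (measurable_pi_apply j).aemeasurable
    (f := fun z => z) (by fun_prop)).symm.trans
    (by rw [(measurePreserving_eval (fun _ : J => stdComplexGaussian) j).map_eq])

lemma MeasureTheory.MemLp.conj {Ω : Type*} [MeasurableSpace Ω] {μ : Measure Ω} {f : Ω → ℂ}
    {p : ℝ≥0∞} (hf : MemLp f p μ) : MemLp (fun ω => conj (f ω)) p μ :=
  hf.star

lemma integral_mul_conj_eval_stdComplexGaussianPi [DecidableEq J] (j l : J) :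
    ∫ z, z j * conj (z l) ∂(stdComplexGaussianPi J) = if j = l then 1 else 0 := by
  split_ifs with h
  · subst h
    rw [← integral_mul_conj_stdComplexGaussian]
    exact (integral_map (μ := stdComplexGaussianPi J) (φ := Function.eval j)
    (measurable_pi_apply j).aemeasurable
      (f := fun z => z * conj z) (by fun_prop)).symm.trans
      (by rw [(measurePreserving_eval (fun _ : J => stdComplexGaussian) j).map_eq])
  · have hi : iIndepFun (fun (i : J) (z : J → ℂ) => z i) (stdComplexGaussianPi J) :=
      iIndepFun_pi (X := fun _ : J => id) (fun _ => aemeasurable_id)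
    have := (hi.indepFun h).comp (φ := id) (ψ := fun z => conj z) (by fun_prop) (by fun_prop)
    have h2 := this.integral_fun_mul_eq_mul_integral
      (memLp_eval_stdComplexGaussianPi j).aestronglyMeasurable
      (memLp_eval_stdComplexGaussianPi l).conj.aestronglyMeasurable
    simp only [Function.comp_apply, id] at h2
    rw [h2, integral_eval_stdComplexGaussianPi, zero_mul]

omit [Fintype I] in
lemma memLp_mulVec_stdComplexGaussianPi (A : Matrix I J ℂ) (i : I) :
    MemLp (fun z : J → ℂ => (A *ᵥ z) i) 2 (stdComplexGaussianPi J) :=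
  memLp_finsetSum _ fun j _ => (memLp_eval_stdComplexGaussianPi j).const_mul _

omit [Fintype I] in
lemma integral_mulVec_stdComplexGaussianPi (A : Matrix I J ℂ) (i : I) :
    ∫ z, (A *ᵥ z) i ∂(stdComplexGaussianPi J) = 0 := by
  simp only [mulVec, dotProduct]
  rw [integral_finsetSum _ fun j _ =>
    ((memLp_eval_stdComplexGaussianPi j).integrable (by norm_num)).const_mul _]
  simp [integral_const_mul, integral_eval_stdComplexGaussianPi]

omit [Fintype I] [Fintype I'] in
/-- The cross-covariance of linear combinations of i.i.d. `CN(0, 1)` variables. -/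
lemma integral_mulVec_mul_conj_mulVec (A : Matrix I J ℂ) (B : Matrix I' J ℂ) (i : I) (i' : I') :
    ∫ z, (A *ᵥ z) i * conj ((B *ᵥ z) i') ∂(stdComplexGaussianPi J) = (A * Bᴴ) i i' := by
  classical
  have hint : ∀ j l, Integrable (fun z : J → ℂ => z j * conj (z l)) (stdComplexGaussianPi J) :=
    fun j l => (memLp_eval_stdComplexGaussianPi j).integrable_mul
      (memLp_eval_stdComplexGaussianPi l).conj
  have h : ∀ z : J → ℂ, (A *ᵥ z) i * conj ((B *ᵥ z) i')
      = ∑ j, ∑ l, A i j * conj (B i' l) * (z j * conj (z l)) := by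
    intro z
    simp only [mulVec, dotProduct, map_sum, map_mul, Finset.sum_mul_sum]
    refine Finset.sum_congr rfl fun j _ => Finset.sum_congr rfl fun l _ => ?_
    ring
  simp_rw [h]
  rw [integral_finsetSum _ fun j _ => integrable_finsetSum _ fun l _ => (hint j l).const_mul _]
  simp_rw [integral_finsetSum _ fun l _ => (hint _ l).const_mul _, integral_const_mul,
    integral_mul_conj_eval_stdComplexGaussianPi]
  simp [mul_apply, conjTranspose_apply]

end ComplexGaussian

/-! ### Erlang laws as laws of squared Gaussian norms -/

section Erlang

open Set Filter Topology

lemma integrableOn_pow_mul_exp_neg (n : ℕ) :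
    IntegrableOn (fun x : ℝ => x ^ n * Real.exp (-x)) (Ioi 0) := by
  have := Real.GammaIntegral_convergent (s := n + 1) (by positivity)
  refine this.congr_fun (fun x _ => ?_) measurableSet_Ioi
  simp [mul_comm]

lemma integral_pow_mul_exp_neg (n : ℕ) :
    ∫ x in Ioi (0 : ℝ), x ^ n * Real.exp (-x) = n.factorial := by
  rw [← Real.Gamma_nat_eq_factorial, Real.Gamma_eq_integral (by positivity)]
  refine setIntegral_congr_fun measurableSet_Ioi fun x _ => ?_
  simp [mul_comm]

lemma integrableOn_pow_mul_cexp_neg (n : ℕ) (t : ℝ) :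
    IntegrableOn (fun x : ℝ => (x : ℂ) ^ n * Complex.exp (-((1 - t * Complex.I) * x))) (Ioi 0) := by
  refine (integrableOn_pow_mul_exp_neg n).mono' (by fun_prop) ?_
  filter_upwards [ae_restrict_mem measurableSet_Ioi] with x hx
  have hx' : 0 < x := hx
  simp [Complex.norm_exp, abs_of_pos hx']

/-- Integration by parts: `x ^ (n + 1) * e^{-bx}` with `b = 1 - it` vanishes at `0` and at infinity,
so the integral for `n + 1` is `(n + 1) / b` times the one for `n`. -/
lemma integral_pow_mul_cexp_neg (n : ℕ) (t : ℝ) :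
    ∫ x in Ioi (0 : ℝ), (x : ℂ) ^ n * Complex.exp (-((1 - t * Complex.I) * x))
      = n.factorial / (1 - t * Complex.I) ^ (n + 1) := by
  have hb : (1 - t * Complex.I : ℂ) ≠ 0 := by
    intro h
    simpa using congrArg Complex.re h
  induction n with
  | zero =>
    have := integral_exp_mul_complex_Ioi (a := -(1 - t * Complex.I)) (by simp) 0
    simp only [neg_mul] at this
    simp only [pow_zero, one_mul, this, Complex.ofReal_zero, mul_zero, neg_zero, Complex.exp_zero,
      neg_div_neg_eq, Nat.factorial_zero, Nat.cast_one, zero_add, pow_one]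
  | succ n ih =>
    have hd : ∀ x ∈ Ici (0 : ℝ), HasDerivAt
        (fun x : ℝ => (x : ℂ) ^ (n + 1) * Complex.exp (-((1 - t * Complex.I) * x)))
        ((n + 1) * ((x : ℂ) ^ n * Complex.exp (-((1 - t * Complex.I) * x)))
          - (1 - t * Complex.I) * ((x : ℂ) ^ (n + 1) * Complex.exp (-((1 - t * Complex.I) * x))))
        x := by
      intro x _
      have h1 : HasDerivAt (fun x : ℝ => (x : ℂ)) 1 x := Complex.ofRealCLM.hasDerivAt
      convert! (h1.pow (n + 1)).mul ((h1.const_mul (1 - t * Complex.I)).neg.cexp) using 1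
      simp
      ring
    have hlim : Tendsto
        (fun x : ℝ => (x : ℂ) ^ (n + 1) * Complex.exp (-((1 - t * Complex.I) * x))) atTop (𝓝 0) := by
      rw [tendsto_zero_iff_norm_tendsto_zero]
      refine (Real.tendsto_pow_mul_exp_neg_atTop_nhds_zero (n + 1)).congr' ?_
      filter_upwards [eventually_gt_atTop 0] with x hx
      simp [Complex.norm_exp, abs_of_pos hx]
    have i1 := (integrableOn_pow_mul_cexp_neg n t).const_mul (n + 1 : ℂ)
    have i2 := (integrableOn_pow_mul_cexp_neg (n + 1) t).const_mul (1 - t * Complex.I)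
    have := integral_Ioi_of_hasDerivAt_of_tendsto' hd (i1.sub i2) hlim
    rw [integral_sub i1 i2, integral_const_mul, integral_const_mul, ih] at this
    simp only [Complex.ofReal_zero, ne_eq, Nat.add_eq_zero_iff, one_ne_zero, and_false,
      not_false_eq_true, zero_pow, zero_mul, sub_zero] at this
    rw [eq_div_iff (pow_ne_zero _ hb), pow_succ, ← mul_assoc, mul_right_comm, mul_comm _ (1 - _)]
    rw [← sub_eq_zero.1 this, Nat.factorial_succ]
    push_cast
    field_simp

/-- The Erlang law with shape `d + 1` and rate `1`. -/
def erlangMeasure (d : ℕ) : Measure ℝ :=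
  (volume.restrict (Ioi 0)).withDensity fun x => ENNReal.ofReal (x ^ d * Real.exp (-x) / d.factorial)

lemma integral_erlangMeasure {E : Type*} [NormedAddCommGroup E] [NormedSpace ℝ E] (d : ℕ)
    (f : ℝ → E) : ∫ x, f x ∂(erlangMeasure d)
      = ∫ x in Ioi (0 : ℝ), (x ^ d * Real.exp (-x) / d.factorial) • f x := by
  rw [erlangMeasure, integral_withDensity_eq_integral_toReal_smul (by fun_prop) (by simp)]
  refine setIntegral_congr_fun measurableSet_Ioi fun x hx => ?_
  have : (0 : ℝ) ≤ x := le_of_lt hx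
  rw [ENNReal.toReal_ofReal (by positivity)]

lemma integrable_erlangMeasure_iff {E : Type*} [NormedAddCommGroup E] [NormedSpace ℝ E] (d : ℕ)
    (f : ℝ → E) : Integrable f (erlangMeasure d)
      ↔ IntegrableOn (fun x => (x ^ d * Real.exp (-x) / d.factorial) • f x) (Ioi 0) := by
  rw [erlangMeasure, integrable_withDensity_iff_integrable_smul' (by fun_prop) (by simp)]
  refine integrable_congr ?_
  filter_upwards [ae_restrict_mem measurableSet_Ioi] with x hx
  have : (0 : ℝ) ≤ x := le_of_lt hx
  rw [ENNReal.toReal_ofReal (by positivity)]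

instance isProbabilityMeasure_erlangMeasure (d : ℕ) : IsProbabilityMeasure (erlangMeasure d) := by
  constructor
  rw [erlangMeasure, withDensity_apply _ MeasurableSet.univ, Measure.restrict_univ,
    ← ofReal_integral_eq_lintegral_ofReal ((integrableOn_pow_mul_exp_neg d).div_const _),
    integral_div, integral_pow_mul_exp_neg, div_self (by positivity), ENNReal.ofReal_one]
  filter_upwards [ae_restrict_mem measurableSet_Ioi] with x hx
  have : (0 : ℝ) ≤ x := le_of_lt hx
  positivity

lemma erlangMeasure_Iic_zero (d : ℕ) : erlangMeasure d (Iic 0) = 0 := by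
  rw [erlangMeasure]
  refine withDensity_absolutelyContinuous _ _ ?_
  rw [Measure.restrict_apply measurableSet_Iic, Iic_inter_Ioi, Ioc_self, measure_empty]

lemma charFun_erlangMeasure (d : ℕ) (t : ℝ) :
    charFun (erlangMeasure d) t = ((1 - t * Complex.I) ^ (d + 1))⁻¹ := by
  rw [charFun_apply_real, integral_erlangMeasure]
  have h : ∀ x : ℝ, (x ^ d * Real.exp (-x) / d.factorial) • Complex.exp (t * x * Complex.I)
      = ((x : ℂ) ^ d * Complex.exp (-((1 - t * Complex.I) * x))) / d.factorial := by
    intro x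
    have : Complex.exp (-((1 - t * Complex.I) * x))
        = Complex.exp (-x) * Complex.exp (t * x * Complex.I) := by
      rw [← Complex.exp_add]
      congr 1
      ring
    rw [this, Complex.real_smul]
    push_cast
    ring
  simp_rw [h]
  rw [integral_div, integral_pow_mul_cexp_neg]
  have : (d.factorial : ℂ) ≠ 0 := by exact_mod_cast d.factorial_ne_zero
  field_simp

/-- Real and imaginary part contribute the same complex Gaussian integral, a multiple of a power
`1/2`. Their product is its square, so no branch of the root survives. -/
lemma charFun_map_normSq_stdComplexGaussian (t : ℝ) :
    charFun (stdComplexGaussian.map fun z => ‖z‖ ^ 2) t = (1 - t * Complex.I)⁻¹ := by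
  rw [charFun_apply_real, integral_map (by fun_prop) (by fun_prop), stdComplexGaussian,
    integral_map measurable_complex_mk.aemeasurable (by fun_prop)]
  have h : ∀ p : ℝ × ℝ, Complex.exp (t * (‖(⟨p.1, p.2⟩ : ℂ)‖ ^ 2 : ℝ) * Complex.I)
      = Complex.exp (t * (p.1 : ℂ) ^ 2 * Complex.I) * Complex.exp (t * (p.2 : ℂ) ^ 2 * Complex.I) := by
    intro p
    rw [← Complex.exp_add, ← Complex.normSq_eq_norm_sq, Complex.normSq_mk]
    congr 1
    push_cast
    ring
  simp_rw [h]
  rw [integral_prod_mul (fun x : ℝ => Complex.exp (t * (x : ℂ) ^ 2 * Complex.I))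
    (fun x : ℝ => Complex.exp (t * (x : ℂ) ^ 2 * Complex.I)),
    integral_gaussianReal_eq_integral_smul (by norm_num)]
  have h2 : ∀ x : ℝ, gaussianPDFReal 0 (1 / 2) x • Complex.exp (t * (x : ℂ) ^ 2 * Complex.I)
      = ((√Real.pi)⁻¹ : ℝ) * Complex.exp (-(1 - t * Complex.I) * (x : ℂ) ^ 2) := by
    intro x
    have hv : 2 * Real.pi * ((1 / 2 : NNReal) : ℝ) = Real.pi := by
      push_cast
      ring
    rw [gaussianPDFReal, Complex.real_smul, hv]
    push_cast
    rw [mul_assoc, ← Complex.exp_add]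
    congr 2
    ring
  simp_rw [h2]
  rw [integral_const_mul, integral_gaussian_complex (by simp), ← sq, mul_pow, ← Complex.cpow_nat_mul]
  have hb : (1 - t * Complex.I : ℂ) ≠ 0 := by
    intro h
    simpa using congrArg Complex.re h
  have hp : (Real.pi : ℂ) ≠ 0 := by exact_mod_cast Real.pi_ne_zero
  rw [← Complex.ofReal_pow, inv_pow, Real.sq_sqrt Real.pi_pos.le]
  norm_num
  field_simp

/-- The squared norm of a vector of `d + 1` i.i.d. `CN(0, 1)` variables has an Erlang law. -/
theorem map_sum_norm_sq_stdComplexGaussianPi {J : Type*} [Fintype J] {d : ℕ}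
    (hJ : Fintype.card J = d + 1) :
    (stdComplexGaussianPi J).map (fun z => ∑ j, ‖z j‖ ^ 2) = erlangMeasure d := by
  have h1 : (stdComplexGaussianPi J).map (fun (z : J → ℂ) j => ‖z j‖ ^ 2)
      = Measure.pi fun _ : J => stdComplexGaussian.map fun z => ‖z‖ ^ 2 :=
    (Measure.pi_map_pi (f := fun _ : J => fun z : ℂ => ‖z‖ ^ 2) (fun _ => by fun_prop))
  have hm : Measurable fun z : ℂ => ‖z‖ ^ 2 := by fun_prop
  have := Measure.isProbabilityMeasure_map (μ := stdComplexGaussian) hm.aemeasurable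
  have h2 : (fun z : J → ℂ => ∑ j, ‖z j‖ ^ 2)
      = (fun p : J → ℝ => ∑ j, p j) ∘ fun (z : J → ℂ) j => ‖z j‖ ^ 2 := rfl
  have hm2 : Measurable (fun z : J → ℂ => ∑ j, ‖z j‖ ^ 2) := by fun_prop
  have := Measure.isProbabilityMeasure_map (μ := stdComplexGaussianPi J) hm2.aemeasurable
  refine Measure.ext_of_charFun ?_
  rw [h2, ← Measure.map_map (by fun_prop) (by fun_prop), h1, charFun_map_sum_pi_eq_prod]
  ext t
  simp [charFun_map_normSq_stdComplexGaussian, charFun_erlangMeasure, hJ]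

end Erlang

/-! ### The logarithmic integral against an Erlang law -/

section RateIntegral

open Set Filter Topology

lemma integrableOn_pow_mul_exp_neg_div {c : ℝ} (hc : 0 < c) (j : ℕ) :
    IntegrableOn (fun x : ℝ => x ^ j * Real.exp (-x) / (x + c)) (Ioi 0) := by
  refine ((integrableOn_pow_mul_exp_neg j).div_const c).mono' ?_ ?_
  · exact (Measurable.aestronglyMeasurable (by fun_prop))
  · filter_upwards [ae_restrict_mem measurableSet_Ioi] with x hx
    have hx' : 0 < x := hx
    rw [Real.norm_of_nonneg (by positivity)]
    gcongr
    linarith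

lemma integral_exp_neg_div {c : ℝ} :
    ∫ x in Ioi (0 : ℝ), Real.exp (-x) / (x + c) = -(Real.exp c * expInt (-c)) := by
  have h := (measurePreserving_add_right volume c).setIntegral_preimage_emb
    (measurableEmbedding_addRight c) (fun t => Real.exp (-t) / t) (Ioi c)
  rw [preimage_add_const_Ioi, sub_self] at h
  rw [expInt, neg_neg, ← h, mul_neg, neg_neg, ← integral_const_mul]
  refine integral_congr_ae (ae_of_all _ fun x => ?_)
  simp only
  rw [← mul_div_assoc, ← Real.exp_add]
  congr 2
  ring

/-- Recursion in `j` from `x ^ (j + 1) / (x + c) = x ^ j - c * x ^ j / (x + c)`. The first term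
integrates to a factorial; the recursion ends in the exponential integral. -/
lemma integral_pow_mul_exp_neg_div {c : ℝ} (hc : 0 < c) (j : ℕ) :
    ∫ x in Ioi (0 : ℝ), x ^ j * Real.exp (-x) / (x + c)
      = (-1) ^ (j + 1) * (c ^ j * Real.exp c * expInt (-c))
        + ∑ q ∈ Finset.Icc 1 j, ((q - 1).factorial : ℝ) * (-c) ^ (j - q) := by
  induction j with
  | zero => simp [integral_exp_neg_div]
  | succ j ih =>
    have h : ∫ x in Ioi (0 : ℝ), x ^ (j + 1) * Real.exp (-x) / (x + c)
        = ∫ x in Ioi (0 : ℝ), (x ^ j * Real.exp (-x) - c * (x ^ j * Real.exp (-x) / (x + c))) := by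
      refine setIntegral_congr_fun measurableSet_Ioi fun x hx => ?_
      have hx' : 0 < x := hx
      have : x + c ≠ 0 := by positivity
      field_simp
      ring
    rw [h, integral_sub (integrableOn_pow_mul_exp_neg j)
      ((integrableOn_pow_mul_exp_neg_div hc j).const_mul c), integral_const_mul, ih,
      integral_pow_mul_exp_neg, Finset.sum_Icc_succ_top (by omega)]
    have : ∑ q ∈ Finset.Icc 1 j, ((q - 1).factorial : ℝ) * (-c) ^ (j + 1 - q)
        = -c * ∑ q ∈ Finset.Icc 1 j, ((q - 1).factorial : ℝ) * (-c) ^ (j - q) := by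
      rw [Finset.mul_sum]
      refine Finset.sum_congr rfl fun q hq => ?_
      rw [Nat.succ_sub (Finset.mem_Icc.1 hq).2, pow_succ]
      ring
    rw [this]
    simp
    ring

lemma integrableOn_log_mul_pow_mul_exp_neg {a : ℝ} (ha : 0 < a) (d : ℕ) :
    IntegrableOn (fun x : ℝ => x ^ d * Real.exp (-x) / d.factorial * Real.log (1 + a * x))
      (Ioi 0) := by
  refine (((integrableOn_pow_mul_exp_neg (d + 1)).div_const (d.factorial : ℝ)).mul_const a).mono'
    (Measurable.aestronglyMeasurable (by fun_prop)) ?_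
  filter_upwards [ae_restrict_mem measurableSet_Ioi] with x hx
  have hx' : 0 < x := hx
  have h1 : 0 ≤ Real.log (1 + a * x) := Real.log_nonneg (by nlinarith [mul_pos ha hx'])
  have h2 : Real.log (1 + a * x) ≤ a * x := by
    have := Real.log_le_sub_one_of_pos (x := 1 + a * x) (by positivity)
    linarith
  rw [Real.norm_of_nonneg (by positivity)]
  calc x ^ d * Real.exp (-x) / d.factorial * Real.log (1 + a * x)
      ≤ x ^ d * Real.exp (-x) / d.factorial * (a * x) := by gcongr
    _ = _ := by ring

lemma tendsto_log_mul_pow_mul_exp_neg {a : ℝ} (ha : 0 < a) (d : ℕ) :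
    Tendsto (fun x : ℝ => x ^ d * Real.exp (-x) / d.factorial * Real.log (1 + a * x))
      atTop (𝓝 0) := by
  have h := ((Real.tendsto_pow_mul_exp_neg_atTop_nhds_zero (d + 1)).div_const
    (d.factorial : ℝ)).mul_const a
  rw [zero_div, zero_mul] at h
  refine squeeze_zero' ?_ ?_ h
  · filter_upwards [eventually_gt_atTop 0] with x hx
    have h1 : 0 ≤ Real.log (1 + a * x) := Real.log_nonneg (by nlinarith [mul_pos ha hx])
    positivity
  · filter_upwards [eventually_gt_atTop 0] with x hx
    have h2 : Real.log (1 + a * x) ≤ a * x := by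
      have := Real.log_le_sub_one_of_pos (x := 1 + a * x) (by positivity)
      linarith
    calc x ^ d * Real.exp (-x) / d.factorial * Real.log (1 + a * x)
        ≤ x ^ d * Real.exp (-x) / d.factorial * (a * x) := by gcongr
      _ = _ := by ring

lemma hasDerivAt_log_one_add_mul {a x : ℝ} (ha : 0 < a) (hx : 0 ≤ x) :
    HasDerivAt (fun x : ℝ => Real.log (1 + a * x)) (x + 1 / a)⁻¹ x := by
  have hp : (1 + a * x) ≠ 0 := by positivity
  have hp' : x + 1 / a ≠ 0 := by positivity
  convert! (((hasDerivAt_id x).const_mul a).const_add 1).log hp using 1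
  simp only [mul_one, id]
  field_simp
  ring

/-- The derivative of the density of index `d + 1` is the density of index `d` minus that of index
`d + 1`. Integrating the derivative of density times logarithm, with zero boundary terms, expresses
the integral for `d + 1` as the one for `d` plus the summand `j = d + 1`. -/
lemma integral_log_mul_pow_mul_exp_neg {a : ℝ} (ha : 0 < a) (d : ℕ) :
    ∫ x in Ioi (0 : ℝ), x ^ d * Real.exp (-x) / d.factorial * Real.log (1 + a * x)
      = ∑ j ∈ Finset.range (d + 1),
        (∫ x in Ioi (0 : ℝ), x ^ j * Real.exp (-x) / (x + 1 / a)) / j.factorial := by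
  have hc : 0 < 1 / a := by positivity
  induction d with
  | zero =>
    have i1 := (integrableOn_pow_mul_exp_neg_div hc 0).div_const (Nat.factorial 0 : ℝ)
    have i2 := integrableOn_log_mul_pow_mul_exp_neg ha 0
    have hd : ∀ x ∈ Ici (0 : ℝ), HasDerivAt
        (fun x : ℝ => x ^ 0 * Real.exp (-x) / (Nat.factorial 0 : ℝ) * Real.log (1 + a * x))
        (x ^ 0 * Real.exp (-x) / (x + 1 / a) / (Nat.factorial 0 : ℝ)
          - x ^ 0 * Real.exp (-x) / (Nat.factorial 0 : ℝ) * Real.log (1 + a * x)) x := by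
      intro x hx
      simp only [pow_zero, one_mul, Nat.factorial_zero, Nat.cast_one, div_one]
      convert! ((hasDerivAt_neg x).exp).mul (hasDerivAt_log_one_add_mul ha hx) using 1
      ring
    have := integral_Ioi_of_hasDerivAt_of_tendsto' hd (i1.sub i2)
      (tendsto_log_mul_pow_mul_exp_neg ha 0)
    rw [integral_sub i1 i2, integral_div] at this
    simp only [mul_zero, add_zero, Real.log_one, sub_zero] at this
    rw [zero_add, Finset.sum_range_one]
    linarith
  | succ d ih =>
    have i1 := (integrableOn_pow_mul_exp_neg_div hc (d + 1)).div_const ((d + 1).factorial : ℝ)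
    have i2 := integrableOn_log_mul_pow_mul_exp_neg ha d
    have i3 := integrableOn_log_mul_pow_mul_exp_neg ha (d + 1)
    have hd : ∀ x ∈ Ici (0 : ℝ), HasDerivAt
        (fun x : ℝ => x ^ (d + 1) * Real.exp (-x) / ((d + 1).factorial : ℝ) * Real.log (1 + a * x))
        (x ^ (d + 1) * Real.exp (-x) / (x + 1 / a) / ((d + 1).factorial : ℝ)
          + x ^ d * Real.exp (-x) / (d.factorial : ℝ) * Real.log (1 + a * x)
          - x ^ (d + 1) * Real.exp (-x) / ((d + 1).factorial : ℝ) * Real.log (1 + a * x)) x := by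
      intro x hx
      convert! (((hasDerivAt_pow (d + 1) x).mul (hasDerivAt_neg x).exp).div_const
        ((d + 1).factorial : ℝ)).mul (hasDerivAt_log_one_add_mul ha hx) using 1
      rw [Nat.factorial_succ]
      have : (d.factorial : ℝ) ≠ 0 := by positivity
      have hp' : x + 1 / a ≠ 0 := by
        have : 0 ≤ x := hx
        positivity
      push_cast
      simp only [Pi.mul_apply]
      -- With the logarithm and `x + 1 / a` as atoms, the identity is one of rational expressions.
      generalize Real.log (1 + a * x) = l
      generalize x + 1 / a = u at *
      field_simp
      ring
    have := integral_Ioi_of_hasDerivAt_of_tendsto' hd ((i1.add i2).sub i3)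
      (tendsto_log_mul_pow_mul_exp_neg ha (d + 1))
    rw [integral_sub (by exact i1.add i2) i3, integral_add i1 i2, integral_div] at this
    simp only [mul_zero, add_zero, Real.log_one, sub_zero] at this
    rw [Finset.sum_range_succ, ← ih]
    linarith

lemma integrable_log_erlangMeasure {a : ℝ} (ha : 0 < a) (d : ℕ) :
    Integrable (fun x => Real.log (1 + a * x)) (erlangMeasure d) := by
  rw [integrable_erlangMeasure_iff]
  exact integrableOn_log_mul_pow_mul_exp_neg ha d

lemma integral_log_erlangMeasure {a : ℝ} (ha : 0 < a) (d : ℕ) :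
    ∫ x, Real.log (1 + a * x) ∂(erlangMeasure d)
      = ∑ j ∈ Finset.range (d + 1), 1 / (j.factorial : ℝ) *
        ((-1) ^ (j + 1) * (1 / a ^ j * Real.exp (1 / a) * expInt (-(1 / a)))
          + ∑ q ∈ Finset.Icc 1 j, ((q - 1).factorial : ℝ) * (-(1 / a)) ^ (j - q)) := by
  rw [integral_erlangMeasure]
  simp only [smul_eq_mul]
  rw [integral_log_mul_pow_mul_exp_neg ha]
  refine Finset.sum_congr rfl fun j _ => ?_
  rw [integral_pow_mul_exp_neg_div (by positivity), _root_.one_div_pow]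
  ring

/-- The closed form sums in the reverse order, `j = ν - p`. -/
lemma rateClosedForm_eq (ν : ℕ) {a b : ℝ} (ha : 0 < a) (hb : 0 < b) :
    rateClosedForm ν a b = (∫ x, Real.log (1 + a * x) ∂(erlangMeasure ν)
      - ∫ x, Real.log (1 + b * x) ∂(erlangMeasure ν)) / Real.log 2 := by
  rw [integral_log_erlangMeasure ha, integral_log_erlangMeasure hb, ← Finset.sum_sub_distrib,
    Finset.sum_div, rateClosedForm, ← Finset.sum_range_reflect]
  refine Finset.sum_congr rfl fun p hp => ?_
  have hp' : p ≤ ν := by simpa [Nat.lt_succ_iff] using hp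
  have e1 : ν - (ν + 1 - 1 - p) = p := by omega
  -- The exponent `p - 1` is an integer, equal to `-1` for `p = 0`; it has the parity of `p + 1`.
  have e2 : (-1 : ℝ) ^ ((ν : ℤ) - ((ν + 1 - 1 - p : ℕ) : ℤ) - 1) = (-1) ^ (p + 1) := by
    have : (ν : ℤ) - ((ν + 1 - 1 - p : ℕ) : ℤ) - 1 = (p : ℤ) - 1 := by omega
    rw [this, zpow_sub₀ (by norm_num), zpow_natCast]
    ring
  rw [e2, e1, Real.logb, Real.log_exp]
  simp only [mul_sub, Finset.sum_sub_distrib]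
  ring

/-- The mean of `log₂ ((1 + a X) / (1 + b X))` for `X` with an Erlang law. -/
theorem integral_logb_div_erlangMeasure (ν : ℕ) {a b : ℝ} (ha : 0 < a) (hb : 0 < b) :
    Integrable (fun x => Real.logb 2 ((1 + a * x) / (1 + b * x))) (erlangMeasure ν) ∧
    ∫ x, Real.logb 2 ((1 + a * x) / (1 + b * x)) ∂(erlangMeasure ν) = rateClosedForm ν a b := by
  have hpos : ∀ᵐ x ∂(erlangMeasure ν), 0 < x := by
    rw [ae_iff]
    simpa [Set.Iic_def, not_lt] using erlangMeasure_Iic_zero ν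
  have h : (fun x => (Real.log (1 + a * x) - Real.log (1 + b * x)) / Real.log 2)
      =ᵐ[erlangMeasure ν] fun x => Real.logb 2 ((1 + a * x) / (1 + b * x)) := by
    filter_upwards [hpos] with x hx
    rw [Real.logb, Real.log_div (by positivity) (by positivity)]
  have ia := integrable_log_erlangMeasure ha ν
  have ib := integrable_log_erlangMeasure hb ν
  refine ⟨((ia.sub ib).div_const _).congr h, ?_⟩
  rw [← integral_congr_ae h, integral_div, integral_sub ia ib, rateClosedForm_eq ν ha hb]

end RateIntegral

/-! ### Diagonal entries of an inverse Gram matrix -/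

section GramInverse

open WithLp

variable {m n : Type*} [Fintype m] [Fintype n]

/-- The columns of a matrix, as vectors of the Euclidean space. -/
def eucCol (G : Matrix m n ℂ) (j : n) : EuclideanSpace ℂ m := toLp 2 (G.col j)

omit [Fintype n] in
lemma inner_eucCol (A B : Matrix m n ℂ) (i j : n) :
    inner ℂ (eucCol A i) (eucCol B j) = (Aᴴ * B) i j := by
  simp [eucCol, PiLp.inner_apply, mul_apply, mul_comm]

lemma isUnit_det_conjTranspose_mul_self [DecidableEq n] {G : Matrix m n ℂ}
    (hG : LinearIndependent ℂ (eucCol G)) : IsUnit (Gᴴ * G).det := by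
  have h : LinearIndependent ℂ G.col :=
    (LinearMap.linearIndependent_iff (WithLp.linearEquiv 2 ℂ (m → ℂ)).symm.toLinearMap
      (LinearEquiv.ker _)).1 hG
  open scoped ComplexOrder in
  exact (isUnit_iff_isUnit_det _).1
    (PosDef.conjTranspose_mul_self G (mulVec_injective_iff.2 h)).isUnit

lemma conjTranspose_gram_inv [DecidableEq n] (G : Matrix m n ℂ) :
    ((Gᴴ * G)⁻¹)ᴴ = (Gᴴ * G)⁻¹ := by
  rw [conjTranspose_nonsing_inv, conjTranspose_mul, conjTranspose_conjTranspose]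

lemma conjTranspose_pinv_mul [DecidableEq n] {G : Matrix m n ℂ} (hG : IsUnit (Gᴴ * G).det) :
    (G * (Gᴴ * G)⁻¹)ᴴ * G = 1 := by
  rw [conjTranspose_mul, conjTranspose_gram_inv, Matrix.mul_assoc, nonsing_inv_mul _ hG]

lemma conjTranspose_pinv_mul_pinv [DecidableEq n] {G : Matrix m n ℂ} (hG : IsUnit (Gᴴ * G).det) :
    (G * (Gᴴ * G)⁻¹)ᴴ * (G * (Gᴴ * G)⁻¹) = (Gᴴ * G)⁻¹ := by
  rw [← Matrix.mul_assoc, conjTranspose_pinv_mul hG, Matrix.one_mul]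

/-- The reciprocal of a diagonal entry of the inverse Gram matrix is the squared distance of the
column to the span of the other columns. -/
theorem gram_inv_apply_re_mul [DecidableEq n] {G : Matrix m n ℂ} (hG : IsUnit (Gᴴ * G).det)
    (k : n) :
    ((Gᴴ * G)⁻¹ k k).re *
      ‖(Submodule.span ℂ (eucCol G '' {j | j ≠ k}))ᗮ.starProjection (eucCol G k)‖ ^ 2 = 1 := by
  set W := Submodule.span ℂ (eucCol G '' {j | j ≠ k})
  set A := G * (Gᴴ * G)⁻¹ with hA
  have h1 : ∀ j, inner ℂ (eucCol A k) (eucCol G j) = if k = j then 1 else 0 := by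
    intro j
    rw [inner_eucCol, hA, conjTranspose_pinv_mul hG, one_apply]
  have h2 : eucCol A k = ∑ j, (Gᴴ * G)⁻¹ j k • eucCol G j := by
    ext i
    simp [eucCol, hA, mul_apply, mul_comm]
  -- Column `k` of the pseudo-inverse is orthogonal to all columns of `G` but the `k`-th.
  have hW : eucCol A k ∈ Wᗮ := by
    rw [Submodule.mem_orthogonal']
    intro u hu
    induction hu using Submodule.span_induction with
    | mem x hx =>
      obtain ⟨j, hj, rfl⟩ := hx
      rw [h1, if_neg (fun h => hj h.symm)]
    | zero => simp
    | add x y _ _ hx hy => rw [inner_add_right, hx, hy, add_zero]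
    | smul c x _ hx => rw [inner_smul_right, hx, mul_zero]
  have hP : Wᗮ.starProjection (eucCol A k) = eucCol A k := Submodule.starProjection_eq_self_iff.2 hW
  -- That column is fixed by the projection and is a combination of columns of `G`, of which the
  -- projection annihilates all but the `k`-th.
  have h3 : eucCol A k = (Gᴴ * G)⁻¹ k k • Wᗮ.starProjection (eucCol G k) := by
    rw [← hP, h2, map_sum, Finset.sum_eq_single k]
    · rw [map_smul]
    · intro j _ hj
      rw [map_smul, Submodule.starProjection_orthogonal_apply_eq_zero
        (Submodule.subset_span (Set.mem_image_of_mem _ hj)), smul_zero]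
    · simp
  have h4 := h1 k
  rw [if_pos rfl, ← hP, Submodule.inner_starProjection_left_eq_right, h3, inner_smul_left,
    inner_self_eq_norm_sq_to_K] at h4
  have h5 : conj ((Gᴴ * G)⁻¹ k k) *
      ((‖Wᗮ.starProjection (eucCol G k)‖ ^ 2 : ℝ) : ℂ) = 1 := by
    rw [Complex.ofReal_pow]
    exact h4
  have h6 := congrArg Complex.re h5
  rwa [Complex.re_mul_ofReal, Complex.conj_re, Complex.one_re] at h6

/-- Scaling the columns multiplies the Gram matrix by the diagonal matrix on both sides. A singular
Gram matrix is covered too, because `Matrix.mul_inv_rev` needs no invertibility; so the identity can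
be used at every outcome. -/
lemma gram_inv_mul_diagonal [DecidableEq n] (G : Matrix m n ℂ) (c : n → ℝ) (hc : ∀ j, c j ≠ 0)
    (k : n) :
    (((G * diagonal fun j => (c j : ℂ))ᴴ * (G * diagonal fun j => (c j : ℂ)))⁻¹ k k)
      = (Gᴴ * G)⁻¹ k k / (c k : ℂ) ^ 2 := by
  have hD : (diagonal fun j => (c j : ℂ))ᴴ = diagonal fun j => (c j : ℂ) := by
    rw [diagonal_conjTranspose]
    congr 1
    ext j
    simp
  have hDi : (diagonal fun j => (c j : ℂ))⁻¹ = diagonal fun j => (c j : ℂ)⁻¹ := by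
    refine inv_eq_right_inv ?_
    rw [diagonal_mul_diagonal, ← diagonal_one]
    congr 1
    ext j
    simp [hc j]
  rw [conjTranspose_mul, hD, ← Matrix.mul_assoc, Matrix.mul_assoc _ Gᴴ G,
    Matrix.mul_inv_rev, Matrix.mul_inv_rev, hDi, ← Matrix.mul_assoc, mul_diagonal, diagonal_mul]
  field_simp

lemma isUnit_det_gram_mul_diagonal [DecidableEq n] {G : Matrix m n ℂ} (hG : IsUnit (Gᴴ * G).det)
    (c : n → ℝ) (hc : ∀ j, c j ≠ 0) :
    IsUnit ((G * diagonal fun j => (c j : ℂ))ᴴ * (G * diagonal fun j => (c j : ℂ))).det := by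
  have hu : IsUnit (diagonal fun j => (c j : ℂ)).det := by
    rw [det_diagonal, isUnit_iff_ne_zero, Finset.prod_ne_zero_iff]
    simpa using hc
  rw [conjTranspose_mul, ← Matrix.mul_assoc, Matrix.mul_assoc _ Gᴴ G, det_mul, det_mul,
    det_conjTranspose]
  exact (hu.star.mul hG).mul hu

lemma measurable_matrix_det [DecidableEq n] {α : Type*} [MeasurableSpace α]
    {F : α → Matrix n n ℂ} (hF : ∀ i j, Measurable fun a => F a i j) :
    Measurable fun a => (F a).det := by
  simp only [det_apply]
  exact Finset.measurable_fun_sum _ fun e _ =>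
    (Finset.measurable_fun_prod _ fun i _ => hF _ _).const_smul _

lemma measurable_matrix_inv_apply [DecidableEq n] {α : Type*} [MeasurableSpace α]
    {F : α → Matrix n n ℂ} (hF : ∀ i j, Measurable fun a => F a i j) (i j : n) :
    Measurable fun a => (F a)⁻¹ i j := by
  simp only [inv_def, Matrix.smul_apply, Ring.inverse_eq_inv', adjugate_apply, smul_eq_mul]
  refine (measurable_matrix_det hF).inv.mul (measurable_matrix_det fun r c => ?_)
  simp only [updateRow_apply]
  split_ifs
  · fun_prop
  · exact hF _ _

omit [Fintype n] in
lemma measurable_mul_apply {l : Type*} {α : Type*} [MeasurableSpace α]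
    {F : α → Matrix l m ℂ} {F' : α → Matrix m n ℂ} (hF : ∀ i j, Measurable fun a => F a i j)
    (hF' : ∀ i j, Measurable fun a => F' a i j) (i : l) (j : n) :
    Measurable fun a => (F a * F' a) i j := by
  simp only [mul_apply]
  fun_prop

omit [Fintype m] [Fintype n] in
lemma measurable_conjTranspose_apply {α : Type*} [MeasurableSpace α]
    {F : α → Matrix m n ℂ} (hF : ∀ i j, Measurable fun a => F a i j) (i : n) (j : m) :
    Measurable fun a => (F a)ᴴ i j :=
  Complex.continuous_conj.measurable.comp (hF j i)

end GramInverse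

/-! ### Projections of Gaussian vectors -/

section ProjectionLaw

open WithLp

variable {m : Type*} [Fintype m]

/-- The squared norm of the projection of a vector of i.i.d. `CN(0, 1)` variables to a subspace has
an Erlang law. -/
theorem map_norm_sq_starProjection (U : Submodule ℂ (EuclideanSpace ℂ m)) {d : ℕ}
    (hU : Module.finrank ℂ U = d + 1) :
    (stdComplexGaussianPi m).map (fun z => ‖U.starProjection (toLp 2 z)‖ ^ 2) = erlangMeasure d := by
  let b := stdOrthonormalBasis ℂ U
  -- The rows are conjugated basis vectors, so `B *ᵥ z` lists the coordinates of the projection in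
  -- an orthonormal basis of `U`.
  let B : Matrix (Fin (Module.finrank ℂ U)) m ℂ := Matrix.of fun i j => conj ((b i : EuclideanSpace ℂ m) j)
  have hB : ∀ z : m → ℂ, ‖U.starProjection (toLp 2 z)‖ ^ 2 = ∑ i, ‖(B *ᵥ z) i‖ ^ 2 := by
    intro z
    rw [Submodule.starProjection_apply, ← Submodule.coe_norm,
      ← b.sum_sq_norm_inner_right]
    refine Finset.sum_congr rfl fun i _ => ?_
    rw [Submodule.inner_orthogonalProjectionOnto_eq_of_mem_left]
    simp [B, PiLp.inner_apply, mulVec, dotProduct, mul_comm]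
  have hBB : B * Bᴴ = 1 := by
    ext i j
    have := orthonormal_iff_ite.1 b.orthonormal i j
    rw [Submodule.coe_inner, PiLp.inner_apply] at this
    simp only [mul_apply, conjTranspose_apply, B, of_apply, one_apply, ← this]
    simp [mul_comm]
  have e : (fun z : m → ℂ => ‖U.starProjection (toLp 2 z)‖ ^ 2)
      = (fun v : Fin (Module.finrank ℂ U) → ℂ => ∑ i, ‖v i‖ ^ 2) ∘ (B *ᵥ ·) := by
    ext z
    exact hB z
  rw [e, ← Measure.map_map (by fun_prop) (by fun_prop), map_mulVec_stdComplexGaussianPi B hBB]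
  exact map_sum_norm_sq_stdComplexGaussianPi (by simpa using hU)

/-- The squared distance to `W` is the squared norm of the projection to `Wᗮ ≠ 0`. Its Erlang law
gives no mass to `0`. -/
lemma ae_notMem_of_finrank_lt (W : Submodule ℂ (EuclideanSpace ℂ m))
    (hW : Module.finrank ℂ W < Fintype.card m) :
    ∀ᵐ z ∂(stdComplexGaussianPi m), (toLp 2 z : EuclideanSpace ℂ m) ∉ W := by
  have h1 := W.finrank_add_finrank_orthogonal
  rw [finrank_euclideanSpace] at h1
  obtain ⟨d, hd⟩ : ∃ d, Module.finrank ℂ Wᗮ = d + 1 := ⟨Module.finrank ℂ Wᗮ - 1, by omega⟩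
  have hlaw := map_norm_sq_starProjection Wᗮ hd
  have h0 : ∀ᵐ x ∂(erlangMeasure d), x ∉ Set.Iic (0 : ℝ) :=
    measure_eq_zero_iff_ae_notMem.1 (erlangMeasure_Iic_zero d)
  rw [← hlaw] at h0
  filter_upwards [ae_of_ae_map (by fun_prop) h0] with z hz hzW
  refine hz ?_
  rw [Submodule.starProjection_orthogonal_apply_eq_zero hzW]
  simp

end ProjectionLaw

/-! ### The Gram matrix of a Gaussian matrix -/

section GaussianMatrix

open WithLp

variable {m n : Type*} [Fintype m] [Fintype n] [DecidableEq m] [DecidableEq n]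

/-- The matrix with the given family of entries. -/
def matrixOf (z : m × n → ℂ) : Matrix m n ℂ := Matrix.of fun i j => z (i, j)

/-- The vector `v`, put into column `k` of a family of entries. -/
def intoCol (k : n) (v : m → ℂ) : m × n → ℂ := fun p => if p.2 = k then v p.1 else 0

/-- The family of entries `z` with column `k` replaced by zeros. -/
def eraseCol (k : n) (z : m × n → ℂ) : m × n → ℂ := fun p => if p.2 = k then 0 else z p

omit [Fintype m] [Fintype n] [DecidableEq m] in
lemma measurable_intoCol (k : n) : Measurable (intoCol k : (m → ℂ) → m × n → ℂ) := by
  refine measurable_pi_lambda _ fun p => ?_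
  simp only [intoCol]
  split_ifs <;> fun_prop

omit [Fintype m] [Fintype n] [DecidableEq m] in
lemma measurable_eraseCol (k : n) : Measurable (eraseCol k : (m × n → ℂ) → m × n → ℂ) := by
  refine measurable_pi_lambda _ fun p => ?_
  simp only [eraseCol]
  split_ifs <;> fun_prop

omit [Fintype m] [Fintype n] [DecidableEq m] in
lemma measurable_eraseCol_add_intoCol (k : n) : Measurable
    fun p : (m × n → ℂ) × (m → ℂ) => eraseCol k p.1 + intoCol k p.2 :=
  ((measurable_eraseCol k).comp measurable_fst).add ((measurable_intoCol k).comp measurable_snd)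

omit [DecidableEq m] in
/-- A matrix of i.i.d. `CN(0, 1)` variables is the independent sum of one of its columns and the
matrix of the others. -/
lemma map_eraseCol_add_intoCol (k : n) :
    ((stdComplexGaussianPi (m × n)).prod (stdComplexGaussianPi m)).map
      (fun p => eraseCol k p.1 + intoCol k p.2) = stdComplexGaussianPi (m × n) := by
  classical
  have hsum : Measurable fun p : (m × n → ℂ) × (m → ℂ) => p.1 + intoCol k p.2 :=
    measurable_fst.add ((measurable_intoCol k).comp measurable_snd)
  have hcomp : (fun p : (m × n → ℂ) × (m → ℂ) => eraseCol k p.1 + intoCol k p.2)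
      = (fun p => p.1 + intoCol k p.2) ∘ Prod.map (eraseCol k) id := rfl
  rw [hcomp, ← Measure.map_map hsum ((measurable_eraseCol k).prodMap measurable_id),
    ← Measure.map_prod_map _ _ (measurable_eraseCol k) measurable_id, Measure.map_id]
  -- `A` reads off column `k` and `C` erases it. They are uncorrelated, hence independent, and their
  -- outputs add up to the original matrix.
  let A : Matrix m (m × n) ℂ := Matrix.of fun i p => if p = (i, k) then 1 else 0
  let C : Matrix (m × n) (m × n) ℂ := diagonal fun p => if p.2 = k then 0 else 1
  have hA : ∀ z, A *ᵥ z = fun i => z (i, k) := by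
    intro z
    ext i
    simp [A, mulVec, dotProduct]
  have hC : ∀ z, C *ᵥ z = eraseCol k z := by
    intro z
    ext p
    simp [C, mulVec_diagonal, eraseCol]
  have hAA : A * Aᴴ = 1 := by
    ext i j
    simp [A, mul_apply, one_apply, eq_comm]
  have hCA : C * Aᴴ = 0 := by
    ext p j
    simp only [C, A, diagonal_mul, conjTranspose_apply, of_apply, Matrix.zero_apply]
    split_ifs <;> simp_all
  have hind := indepFun_mulVec_stdComplexGaussianPi C A hCA
  have hlaw := map_mulVec_stdComplexGaussianPi A hAA
  rw [indepFun_iff_map_prod_eq_prod_map_map (by fun_prop) (by fun_prop), hlaw] at hind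
  have hC' : (fun z : m × n → ℂ => C *ᵥ z) = eraseCol k := funext hC
  rw [← hC', ← hind, Measure.map_map hsum (by fun_prop)]
  have : (fun p : (m × n → ℂ) × (m → ℂ) => p.1 + intoCol k p.2) ∘ (fun z => (C *ᵥ z, A *ᵥ z))
      = id := by
    ext z p
    simp only [Function.comp_apply, hC, hA, Pi.add_apply, eraseCol, intoCol, id]
    split_ifs with h
    · rw [zero_add, ← h]
    · simp
  rw [this, Measure.map_id]

omit [Fintype m] [Fintype n] [DecidableEq m] [DecidableEq n] in
lemma eucCol_matrixOf (z : m × n → ℂ) (j : n) : eucCol (matrixOf z) j = toLp 2 fun i => z (i, j) :=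
  rfl

omit [Fintype m] [Fintype n] [DecidableEq m] in
lemma eucCol_add_intoCol_self (k : n) (w : m × n → ℂ) (v : m → ℂ) :
    eucCol (matrixOf (eraseCol k w + intoCol k v)) k = toLp 2 v := by
  ext i
  simp [eucCol_matrixOf, eraseCol, intoCol]

omit [Fintype m] [Fintype n] [DecidableEq m] in
lemma eucCol_add_intoCol_of_ne {k j : n} (hj : j ≠ k) (w : m × n → ℂ) (v : m → ℂ) :
    eucCol (matrixOf (eraseCol k w + intoCol k v)) j = eucCol (matrixOf w) j := by
  ext i
  simp [eucCol_matrixOf, eraseCol, intoCol, hj]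

omit [DecidableEq m] in
/-- To prove that a property holds for almost every Gaussian matrix, one column may be replaced by
an independent copy. -/
lemma ae_matrix_of_ae_column (k : n) {p : (m × n → ℂ) → Prop} (hp : MeasurableSet {z | p z})
    (h : ∀ᵐ w ∂(stdComplexGaussianPi (m × n)), ∀ᵐ v ∂(stdComplexGaussianPi m),
      p (eraseCol k w + intoCol k v)) : ∀ᵐ z ∂(stdComplexGaussianPi (m × n)), p z := by
  have hm := measurable_eraseCol_add_intoCol (m := m) k
  rw [← map_eraseCol_add_intoCol k, ae_map_iff hm.aemeasurable hp]
  exact (Measure.ae_prod_iff_ae_ae (hm hp)).2 h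

omit [DecidableEq m] in
-- Columns are added one at a time: a fresh Gaussian column almost surely avoids the span of the
-- earlier ones, whose dimension is at most `s.card`, still less than the number of rows.
lemma ae_linearIndepOn_eucCol (s : Finset n) (hs : s.card ≤ Fintype.card m) :
    ∀ᵐ z ∂(stdComplexGaussianPi (m × n)), LinearIndepOn ℂ (eucCol (matrixOf z)) (s : Set n) := by
  induction s using Finset.induction_on with
  | empty => simp
  | insert k s hk ih =>
    rw [Finset.card_insert_of_notMem hk] at hs
    have hmeas : MeasurableSet
        {z : m × n → ℂ | LinearIndepOn ℂ (eucCol (matrixOf z)) ((insert k s : Finset n) : Set n)} := by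
      have hc : Continuous fun (z : m × n → ℂ) (j : ((insert k s : Finset n) : Set n)) =>
          eucCol (matrixOf z) (j : n) := by
        refine continuous_pi fun j => ?_
        simp only [eucCol_matrixOf]
        fun_prop
      -- Measurability holds because linear independence is an open condition.
      exact (isOpen_setOfPred_linearIndependent.preimage hc).measurableSet
    refine ae_matrix_of_ae_column k hmeas ?_
    filter_upwards [ih (by omega)] with w hw
    have hfin : Module.finrank ℂ (Submodule.span ℂ (eucCol (matrixOf w) '' (s : Set n)))
        < Fintype.card m := by
      rw [← Finset.coe_image]
      exact ((finrank_span_finset_le_card _).trans Finset.card_image_le).trans_lt (by omega)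
    filter_upwards [ae_notMem_of_finrank_lt _ hfin] with v hv
    have heq : Set.EqOn (eucCol (matrixOf (eraseCol k w + intoCol k v))) (eucCol (matrixOf w))
        (s : Set n) := fun j hj =>
      eucCol_add_intoCol_of_ne (ne_of_mem_of_not_mem (Finset.mem_coe.1 hj) hk) w v
    rw [Finset.coe_insert]
    refine LinearIndepOn.insert ((linearIndepOn_congr heq).2 hw) ?_
    rwa [heq.image_eq, eucCol_add_intoCol_self]

omit [DecidableEq m] in
/-- The columns of an `m × n` matrix of i.i.d. `CN(0, 1)` variables with `n ≤ m` are almost surely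
linearly independent. -/
theorem ae_isUnit_det_gram (h : Fintype.card n ≤ Fintype.card m) :
    ∀ᵐ z ∂(stdComplexGaussianPi (m × n)),
      IsUnit ((matrixOf z)ᴴ * (matrixOf z)).det := by
  filter_upwards [ae_linearIndepOn_eucCol (m := m) Finset.univ (by simpa using h)] with z hz
  refine isUnit_det_conjTranspose_mul_self ?_
  rwa [Finset.coe_univ, linearIndepOn_univ_iff] at hz

omit [DecidableEq m] in
lemma measurable_gram_inv_apply (k : n) :
    Measurable fun z : m × n → ℂ => (((matrixOf z)ᴴ * (matrixOf z))⁻¹ k k).re⁻¹ := by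
  have h : ∀ i j, Measurable fun z : m × n → ℂ => matrixOf z i j := fun i j => by
    simp only [matrixOf, of_apply]
    fun_prop
  exact (Complex.measurable_re.comp (measurable_matrix_inv_apply (measurable_mul_apply
    (measurable_conjTranspose_apply h) h) k k)).inv

/-- Fubini: if the law given the first coordinate is almost surely the same, it is the unconditional
law. Used to freeze all columns but one. -/
lemma MeasureTheory.Measure.map_prod_eq_of_ae_map_eq {α β γ : Type*} [MeasurableSpace α] [MeasurableSpace β]
    [MeasurableSpace γ] {μ : Measure α} {ν : Measure β} {κ : Measure γ} [IsProbabilityMeasure μ]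
    [SFinite ν] {F : α × β → γ} (hF : Measurable F)
    (h : ∀ᵐ a ∂μ, ν.map (fun b => F (a, b)) = κ) : (μ.prod ν).map F = κ := by
  ext s hs
  rw [Measure.map_apply hF hs, Measure.prod_apply (hF hs)]
  have : (fun a => ν (Prod.mk a ⁻¹' (F ⁻¹' s))) =ᵐ[μ] fun _ => κ s := by
    filter_upwards [h] with a ha
    rw [← ha, Measure.map_apply (by fun_prop) hs]
    rfl
  rw [lintegral_congr_ae this]
  simp

omit [DecidableEq m] in
/-- The reciprocal of a diagonal entry of `(Zᴴ Z)⁻¹`, for a matrix `Z` of i.i.d. `CN(0, 1)`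
variables, has an Erlang law. -/
theorem map_inv_gram_inv (h : Fintype.card n ≤ Fintype.card m) (k : n) :
    (stdComplexGaussianPi (m × n)).map
      (fun z => (((matrixOf z)ᴴ * (matrixOf z))⁻¹ k k).re⁻¹)
      = erlangMeasure (Fintype.card m - Fintype.card n) := by
  have hm := measurable_eraseCol_add_intoCol (m := m) k
  have hg := measurable_gram_inv_apply (m := m) k
  conv_lhs => rw [← map_eraseCol_add_intoCol k]
  rw [Measure.map_map hg hm]
  refine Measure.map_prod_eq_of_ae_map_eq (hg.comp hm) ?_
  filter_upwards [ae_linearIndepOn_eucCol (m := m) (Finset.univ.erase k)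
    ((Finset.card_le_univ _).trans h)] with w hw
  have hset : ((Finset.univ.erase k : Finset n) : Set n) = {j | j ≠ k} := by
    ext j
    simp
  rw [hset] at hw
  set W := Submodule.span ℂ (eucCol (matrixOf w) '' {j | j ≠ k})
  have hn : 0 < Fintype.card n := Fintype.card_pos_iff.2 ⟨k⟩
  have hW : Module.finrank ℂ W = Fintype.card n - 1 := by
    have := finrank_span_eq_card hw.linearIndependent
    rw [← Set.image_eq_range] at this
    rw [this]
    simp [Finset.filter_ne', Finset.card_erase_of_mem]
  have hW' := W.finrank_add_finrank_orthogonal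
  rw [finrank_euclideanSpace, hW] at hW'
  -- The other columns span dimension `n - 1`, so `Wᗮ` has dimension `(m - n) + 1`, which is index
  -- `m - n` of the Erlang law.
  rw [← map_norm_sq_starProjection Wᗮ
    (d := Fintype.card m - Fintype.card n) (by omega)]
  refine Measure.map_congr ?_
  filter_upwards [ae_notMem_of_finrank_lt W (by omega)] with v hv
  have heq : Set.EqOn (eucCol (matrixOf (eraseCol k w + intoCol k v))) (eucCol (matrixOf w))
      {j | j ≠ k} := fun j hj => eucCol_add_intoCol_of_ne hj w v
  have hli : LinearIndependent ℂ (eucCol (matrixOf (eraseCol k w + intoCol k v))) := by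
    rw [← linearIndepOn_univ_iff]
    have huniv : (Set.univ : Set n) = insert k {j | j ≠ k} := by
      ext j
      simp [em]
    rw [huniv]
    refine LinearIndepOn.insert ((linearIndepOn_congr heq).2 hw) ?_
    rwa [heq.image_eq, eucCol_add_intoCol_self]
  have := gram_inv_apply_re_mul (isUnit_det_conjTranspose_mul_self hli) k
  rw [heq.image_eq, eucCol_add_intoCol_self] at this
  exact inv_eq_of_mul_eq_one_right this

end GaussianMatrix

/-! ### Second moments under independence -/

section SecondMoments

variable {Ω : Type*} [MeasurableSpace Ω] {μ : Measure Ω}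

lemma lintegral_enorm_sq_eq {f : Ω → ℂ} (hf : MemLp f 2 μ) :
    ∫⁻ ω, ‖f ω‖ₑ ^ 2 ∂μ = ENNReal.ofReal (∫ ω, f ω * conj (f ω) ∂μ).re := by
  have h : ∀ ω, f ω * conj (f ω) = ((‖f ω‖ ^ 2 : ℝ) : ℂ) := fun ω => by
    rw [Complex.mul_conj, Complex.normSq_eq_norm_sq]
  simp_rw [h]
  rw [integral_complex_ofReal, Complex.ofReal_re,
    ofReal_integral_eq_lintegral_ofReal ((memLp_two_iff_integrable_sq_norm hf.1).1 hf)
      (ae_of_all _ fun ω => by positivity)]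
  refine lintegral_congr fun ω => ?_
  rw [ENNReal.ofReal_pow (norm_nonneg _), ofReal_norm]

/-- The second moment of a linear combination of uncorrelated variables. -/
lemma lintegral_enorm_sq_sum {ι : Type*} [Fintype ι] [DecidableEq ι] {V : ι → Ω → ℂ} {v : ι → ℝ}
    (hV : ∀ i, MemLp (V i) 2 μ)
    (hcov : ∀ i j, ∫ ω, V i ω * conj (V j ω) ∂μ = if i = j then (v i : ℂ) else 0) (c : ι → ℂ) :
    ∫⁻ ω, ‖∑ i, c i * V i ω‖ₑ ^ 2 ∂μ = ENNReal.ofReal (∑ i, ‖c i‖ ^ 2 * v i) := by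
  have hint : ∀ i j, Integrable (fun ω => V i ω * conj (V j ω)) μ :=
    fun i j => (hV i).integrable_mul (hV j).conj
  rw [lintegral_enorm_sq_eq (memLp_finsetSum _ fun i _ => (hV i).const_mul _)]
  have h : ∀ ω, (∑ i, c i * V i ω) * conj (∑ i, c i * V i ω)
      = ∑ i, ∑ j, c i * conj (c j) * (V i ω * conj (V j ω)) := by
    intro ω
    simp only [map_sum, map_mul, Finset.sum_mul_sum]
    refine Finset.sum_congr rfl fun j _ => Finset.sum_congr rfl fun l _ => ?_
    ring
  simp_rw [h]
  rw [integral_finsetSum _ fun j _ => integrable_finsetSum _ fun l _ => (hint j l).const_mul _]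
  simp_rw [integral_finsetSum _ fun l _ => (hint _ l).const_mul _, integral_const_mul, hcov]
  congr 1
  simp only [mul_ite, mul_zero, Finset.sum_ite_eq, Finset.mem_univ, if_true, Complex.re_sum]
  refine Finset.sum_congr rfl fun i _ => ?_
  rw [Complex.mul_conj, Complex.normSq_eq_norm_sq, ← Complex.ofReal_mul, Complex.ofReal_re]

lemma ProbabilityTheory.IndepFun.memLp_two_mul {f g : Ω → ℂ} (hfg : IndepFun f g μ)
    (hf : MemLp f 2 μ) (hg : MemLp g 2 μ) : MemLp (fun ω => f ω * g ω) 2 μ := by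
  refine (memLp_two_iff_integrable_sq_norm (hf.1.mul hg.1)).2 ?_
  have := (hfg.comp (φ := fun z => ‖z‖ ^ 2) (ψ := fun z => ‖z‖ ^ 2) (by fun_prop)
    (by fun_prop)).integrable_mul ((memLp_two_iff_integrable_sq_norm hf.1).1 hf)
    ((memLp_two_iff_integrable_sq_norm hg.1).1 hg)
  refine this.congr (ae_of_all _ fun ω => ?_)
  simp [mul_pow]

/-- Both hypotheses together make the joint law of the three variables a product, which may be
regrouped. It serves for `X` the estimate, `Y` the error and `Z` the data. -/
lemma ProbabilityTheory.IndepFun.prodMk_right_of_prodMk_left {α β γ : Type*} [MeasurableSpace α]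
    [MeasurableSpace β] [MeasurableSpace γ] [IsProbabilityMeasure μ] {X : Ω → α} {Y : Ω → β}
    {Z : Ω → γ} (hX : Measurable X) (hY : Measurable Y) (hZ : Measurable Z)
    (hXY : IndepFun X Y μ) (h : IndepFun (fun ω => (X ω, Y ω)) Z μ) :
    IndepFun X (fun ω => (Y ω, Z ω)) μ := by
  have := Measure.isProbabilityMeasure_map (μ := μ) hX.aemeasurable
  have := Measure.isProbabilityMeasure_map (μ := μ) hY.aemeasurable
  have := Measure.isProbabilityMeasure_map (μ := μ) hZ.aemeasurable
  have hYZ : IndepFun Y Z μ := h.comp (φ := Prod.snd) (ψ := id) measurable_snd measurable_id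
  rw [indepFun_iff_map_prod_eq_prod_map_map (by fun_prop) (by fun_prop)] at hXY h hYZ ⊢
  rw [hYZ, ← Measure.prodAssoc_prod, ← hXY, ← h, Measure.map_map (by fun_prop) (by fun_prop)]
  rfl

variable {m n : Type*} {A : Ω → Matrix m n ℂ} {x : Ω → n → ℂ}

lemma ProbabilityTheory.IndepFun.matrix_apply (hind : IndepFun (fun ω i j => A ω i j) x μ)
    (i : m) (j j' : n) : IndepFun (fun ω => A ω i j) (fun ω => x ω j') μ :=
  hind.comp (φ := fun a : m → n → ℂ => a i j) (ψ := fun x : n → ℂ => x j') (by fun_prop)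
    (by fun_prop)

lemma integral_mul_mul_conj_of_indepFun (hA : ∀ i j, MemLp (fun ω => A ω i j) 2 μ)
    (hx : ∀ j, MemLp (fun ω => x ω j) 2 μ) (hind : IndepFun (fun ω i j => A ω i j) x μ)
    (i i' : m) (j j' : n) :
    ∫ ω, A ω i j * x ω j * conj (A ω i' j' * x ω j') ∂μ
      = (∫ ω, A ω i j * conj (A ω i' j') ∂μ) * ∫ ω, x ω j * conj (x ω j') ∂μ := by
  have hφ : Measurable fun a : m → n → ℂ => a i j * conj (a i' j') :=
    (show Measurable fun a : m → n → ℂ => a i j by fun_prop).mul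
      (Complex.continuous_conj.measurable.comp
        (show Measurable fun a : m → n → ℂ => a i' j' by fun_prop))
  have hψ : Measurable fun x : n → ℂ => x j * conj (x j') :=
    (measurable_pi_apply j).mul (Complex.continuous_conj.measurable.comp (measurable_pi_apply j'))
  have h : IndepFun (fun ω => A ω i j * conj (A ω i' j')) (fun ω => x ω j * conj (x ω j')) μ :=
    hind.comp hφ hψ
  rw [← h.integral_fun_mul_eq_mul_integral ((hA i j).1.mul (hA i' j').conj.1)
    ((hx j).1.mul (hx j').conj.1)]
  refine integral_congr_ae (ae_of_all _ fun ω => ?_)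
  simp only [map_mul]
  ring

lemma integral_mul_mul_conj_of_indepFun' (hA : ∀ i j, MemLp (fun ω => A ω i j) 2 μ)
    (hx : ∀ j, MemLp (fun ω => x ω j) 2 μ) (hind : IndepFun (fun ω i j => A ω i j) x μ)
    (i : m) (j j' : n) :
    ∫ ω, A ω i j * x ω j * conj (x ω j') ∂μ
      = (∫ ω, A ω i j ∂μ) * ∫ ω, x ω j * conj (x ω j') ∂μ := by
  have hψ : Measurable fun x : n → ℂ => x j * conj (x j') :=
    (measurable_pi_apply j).mul (Complex.continuous_conj.measurable.comp (measurable_pi_apply j'))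
  have h : IndepFun (fun ω => A ω i j) (fun ω => x ω j * conj (x ω j')) μ :=
    hind.comp (φ := fun a : m → n → ℂ => a i j) (by fun_prop) hψ
  rw [← h.integral_fun_mul_eq_mul_integral (hA i j).1 ((hx j).1.mul (hx j').conj.1)]
  refine integral_congr_ae (ae_of_all _ fun ω => ?_)
  simp only
  ring

variable [Fintype n]

lemma memLp_mulVec_of_indepFun (hA : ∀ i j, MemLp (fun ω => A ω i j) 2 μ)
    (hx : ∀ j, MemLp (fun ω => x ω j) 2 μ)
    (hind : IndepFun (fun ω i j => A ω i j) x μ) (i : m) :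
    MemLp (fun ω => (A ω *ᵥ x ω) i) 2 μ :=
  memLp_finsetSum _ fun j _ => (hind.matrix_apply i j j).memLp_two_mul (hA i j) (hx j)

/-- The covariance of `A x`, for a matrix `A` and an independent vector `x` with uncorrelated
entries. -/
lemma integral_mulVec_mul_conj_of_indepFun [DecidableEq n] {w : m → m → n → ℂ}
    (hA : ∀ i j, MemLp (fun ω => A ω i j) 2 μ) (hx : ∀ j, MemLp (fun ω => x ω j) 2 μ)
    (hcx : ∀ j j', ∫ ω, x ω j * conj (x ω j') ∂μ = if j = j' then 1 else 0)
    (hcA : ∀ i i' j, ∫ ω, A ω i j * conj (A ω i' j) ∂μ = w i i' j)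
    (hind : IndepFun (fun ω i j => A ω i j) x μ) (i i' : m) :
    ∫ ω, (A ω *ᵥ x ω) i * conj ((A ω *ᵥ x ω) i') ∂μ = ∑ j, w i i' j := by
  have hm : ∀ i j, MemLp (fun ω => A ω i j * x ω j) 2 μ := fun i j =>
    (hind.matrix_apply i j j).memLp_two_mul (hA i j) (hx j)
  have hint : ∀ j j', Integrable (fun ω => A ω i j * x ω j * conj (A ω i' j' * x ω j')) μ :=
    fun j j' => (hm i j).integrable_mul (hm i' j').conj
  simp only [mulVec, dotProduct, map_sum, Finset.sum_mul_sum]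
  rw [integral_finsetSum _ fun j _ => integrable_finsetSum _ fun l _ => hint j l]
  -- The entries of `x` are uncorrelated, so only `j = j'` survives; hence covariances of `A` matter
  -- only within a column.
  simp_rw [integral_finsetSum _ fun l _ => hint _ l,
    integral_mul_mul_conj_of_indepFun hA hx hind, hcx]
  simp [hcA]

/-- If `A` is centered, `A x` is uncorrelated with `x`. -/
lemma integral_mulVec_mul_conj_eq_zero (hA : ∀ i j, MemLp (fun ω => A ω i j) 2 μ)
    (hx : ∀ j, MemLp (fun ω => x ω j) 2 μ) (hA0 : ∀ i j, ∫ ω, A ω i j ∂μ = 0)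
    (hind : IndepFun (fun ω i j => A ω i j) x μ) (i : m) (k : n) :
    ∫ ω, (A ω *ᵥ x ω) i * conj (x ω k) ∂μ = 0 := by
  have hint : ∀ j, Integrable (fun ω => A ω i j * x ω j * conj (x ω k)) μ := fun j =>
    ((hind.matrix_apply i j j).memLp_two_mul (hA i j) (hx j)).integrable_mul (hx k).conj
  simp only [mulVec, dotProduct, Finset.sum_mul]
  rw [integral_finsetSum _ fun j _ => hint j]
  simp_rw [integral_mul_mul_conj_of_indepFun' hA hx hind, hA0, zero_mul, Finset.sum_const_zero]

end SecondMoments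

/-! ### Conditional expectations given an independent variable -/

section CondLExp

variable {Ω α β : Type*} [MeasurableSpace Ω] [MeasurableSpace α] [MeasurableSpace β]
  {μ : Measure Ω} [IsProbabilityMeasure μ]

/-- Conditioning on `X` a function of `X` and of a variable that is independent of `X`. -/
theorem condLExp_comp_of_indepFun {X : Ω → α} {Y : Ω → β} (hX : Measurable X) (hY : Measurable Y)
    (hXY : IndepFun X Y μ) {f : α × β → ℝ≥0∞} (hf : Measurable f) :
    μ⁻[fun ω => f (X ω, Y ω) | MeasurableSpace.comap X inferInstance]
      =ᵐ[μ] fun ω => ∫⁻ ω', f (X ω, Y ω') ∂μ := by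
  have hY' : ∀ a, ∫⁻ ω', f (a, Y ω') ∂μ = ∫⁻ b, f (a, b) ∂(μ.map Y) := fun a =>
    (lintegral_map (hf.comp measurable_prodMk_left) hY).symm
  have := Measure.isProbabilityMeasure_map (μ := μ) hY.aemeasurable
  have hg : Measurable fun a => ∫⁻ b, f (a, b) ∂(μ.map Y) := hf.lintegral_prod_right'
  simp_rw [hY']
  -- The candidate is a function of `X`, so it remains to compare integrals over the sets `X ⁻¹' t`;
  -- there Tonelli applies to the product law of `(X, Y)`.
  refine (ae_eq_condLExp hX.comap_le μ _ (hg.comp (comap_measurable X)) ?_).symm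
  rintro s ⟨t, ht, rfl⟩
  have h1 : ∫⁻ ω in X ⁻¹' t, f (X ω, Y ω) ∂μ
      = ∫⁻ p, (Prod.fst ⁻¹' t).indicator f p ∂(μ.map fun ω => (X ω, Y ω)) := by
    rw [lintegral_map (hf.indicator (measurable_fst ht)) (by fun_prop),
      ← lintegral_indicator (hX ht)]
    rfl
  rw [h1, (indepFun_iff_map_prod_eq_prod_map_map (by fun_prop) (by fun_prop)).1 hXY,
    lintegral_prod _ (hf.indicator (measurable_fst ht)).aemeasurable,
    ← lintegral_indicator (hX ht), lintegral_map ?_ hX]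
  · refine lintegral_congr fun ω => ?_
    by_cases h : X ω ∈ t
    · simp [Set.indicator, h]
    · simp [Set.indicator, h]
  · exact (hf.indicator (measurable_fst ht)).lintegral_prod_right'

/-- The conditional second moment of a linear combination of uncorrelated variables whose
coefficients are known. -/
theorem condLExp_enorm_sq_sum {ι : Type*} [Fintype ι] [DecidableEq ι] {X : Ω → α}
    {V : ι → Ω → ℂ} {v : ι → ℝ} {c : ι → α → ℂ} (hX : Measurable X) (hVm : ∀ i, Measurable (V i))
    (hXV : IndepFun X (fun ω i => V i ω) μ) (hV : ∀ i, MemLp (V i) 2 μ)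
    (hcov : ∀ i j, ∫ ω, V i ω * conj (V j ω) ∂μ = if i = j then (v i : ℂ) else 0)
    (hc : ∀ i, Measurable (c i)) :
    μ⁻[fun ω => ‖∑ i, c i (X ω) * V i ω‖ₑ ^ 2 | MeasurableSpace.comap X inferInstance]
      =ᵐ[μ] fun ω => ENNReal.ofReal (∑ i, ‖c i (X ω)‖ ^ 2 * v i) := by
  have hf : Measurable fun p : α × (ι → ℂ) => ∑ i, c i p.1 * p.2 i :=
    Finset.measurable_fun_sum _ fun i _ => ((hc i).comp measurable_fst).mul
      ((measurable_pi_apply i).comp measurable_snd)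
  have hf2 : Measurable fun p : α × (ι → ℂ) => ‖∑ i, c i p.1 * p.2 i‖ₑ ^ 2 := hf.enorm.pow_const 2
  have h1 := condLExp_comp_of_indepFun (Y := fun ω i => V i ω) hX (measurable_pi_lambda _ hVm) hXV
    hf2
  filter_upwards [h1] with ω hω
  rw [hω]
  exact lintegral_enorm_sq_sum hV hcov _

end CondLExp

/-! ### Pilots, channels and errors as linear maps of the coefficients -/

namespace Uplink

variable {L K M τ : ℕ} {Ω : Type*} (S : Uplink L K M τ Ω)

/-- The indices of the fading and noise coefficients. -/
abbrev CoefIdx (L K M τ : ℕ) : Type := (Fin L × Fin M × Fin K) ⊕ (Fin M × Fin τ) ⊕ Fin M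

/-- The variance of the entries of column `k` of the projected pilot matrix. -/
def pilotVar (k : Fin K) : ℝ := τ * S.P * ∑ j, S.β j k + 1

/-- The coefficient of the MMSE estimator of `G_i`. -/
def mmseCoef (i : Fin L) (k : Fin K) : ℝ := √(τ * S.P) * S.β i k / S.pilotVar k

/-- The projected pilot matrix, as a linear map of the fading and noise coefficients. -/
def pilotMat : Matrix (Fin M × Fin K) (CoefIdx L K M τ) ℂ := Matrix.of fun p j =>
  match j with
  | .inl (i, m, k) => if p.1 = m ∧ p.2 = k then ((√(τ * S.P) * √(S.β i k) : ℝ) : ℂ) else 0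
  | .inr (.inl (m, t)) => if p.1 = m then conj (S.Ψ t p.2) else 0
  | .inr (.inr _) => 0

/-- The channel matrix `G_i`, as a linear map of the fading and noise coefficients. -/
def channelMat (i : Fin L) : Matrix (Fin M × Fin K) (CoefIdx L K M τ) ℂ := Matrix.of fun p j =>
  match j with
  | .inl (i', m, k) => if i = i' ∧ p.1 = m ∧ p.2 = k then ((√(S.β i k) : ℝ) : ℂ) else 0
  | .inr _ => 0

/-- The data-phase noise, as a linear map of the fading and noise coefficients. -/
def noiseMat : Matrix (Fin M) (CoefIdx L K M τ) ℂ := Matrix.of fun p j =>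
  match j with
  | .inr (.inr m) => if p = m then 1 else 0
  | _ => 0

/-- The estimation error `ξ_i`, as a linear map of the fading and noise coefficients. -/
def errMat (i : Fin L) : Matrix (Fin M × Fin K) (CoefIdx L K M τ) ℂ :=
  S.channelMat i - diagonal (fun p : Fin M × Fin K => (S.mmseCoef i p.2 : ℂ)) * S.pilotMat

lemma pilotMat_mulVec (ω : Ω) (m : Fin M) (k : Fin K)
    (hΨ : S.Ψᴴ * S.Ψ = 1) : (S.pilotMat *ᵥ fun j => S.gaussians j ω) (m, k) = S.Ypt ω m k := by
  have h : S.Ψᵀ * S.Ψ.map conj = 1 := by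
    have := congrArg (fun A : Matrix (Fin K) (Fin K) ℂ => A.map conj) hΨ
    simpa [Matrix.map_mul, conjTranspose, Matrix.map_map, Function.comp_def] using this
  rw [Ypt, Yp, Matrix.add_mul, Matrix.smul_mul, Matrix.sum_mul]
  simp_rw [Matrix.mul_assoc, h, Matrix.mul_one]
  simp only [mulVec, dotProduct, pilotMat, of_apply, Fintype.sum_sum_type, Fintype.sum_prod_type,
    gaussians, ite_and, ite_mul, zero_mul, Finset.sum_ite_irrel, Finset.sum_ite_eq,
    Finset.mem_univ, if_true, Finset.sum_const_zero, add_zero, Matrix.add_apply,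
    Matrix.smul_apply, Matrix.sum_apply, G, mul_diagonal, smul_eq_mul, Finset.mul_sum]
  rw [mul_apply]
  congr 1
  · refine Finset.sum_congr rfl fun i _ => ?_
    push_cast
    ring
  · refine Finset.sum_congr rfl fun t _ => ?_
    rw [map_apply, mul_comm]

lemma channelMat_mulVec (i : Fin L) (ω : Ω) (m : Fin M) (k : Fin K) :
    (S.channelMat i *ᵥ fun j => S.gaussians j ω) (m, k) = S.G i ω m k := by
  simp only [mulVec, dotProduct, channelMat, of_apply, Fintype.sum_sum_type, Fintype.sum_prod_type,
    gaussians, ite_and, ite_mul, zero_mul, Finset.sum_ite_irrel, Finset.sum_ite_eq,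
    Finset.mem_univ, if_true, Finset.sum_const_zero, add_zero, G, mul_diagonal, mul_comm]

lemma noiseMat_mulVec (ω : Ω) (m : Fin M) :
    (noiseMat *ᵥ fun j => S.gaussians j ω) m = S.n ω m := by
  simp [mulVec, dotProduct, noiseMat, Fintype.sum_sum_type, gaussians]

section Covariance

variable {S} (hP : 0 ≤ S.P) (hβ : ∀ i k, 0 ≤ S.β i k)

include hP hβ in
-- With common pilots the fading of all cells adds up in the same column, while orthonormality keeps
-- different columns uncorrelated and the projected noise at variance `1`.
lemma pilotMat_mul_conjTranspose (hΨ : S.Ψᴴ * S.Ψ = 1) :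
    S.pilotMat * S.pilotMatᴴ = diagonal fun p : Fin M × Fin K => (S.pilotVar p.2 : ℂ) := by
  ext ⟨m, k⟩ ⟨m', k'⟩
  have h := congrFun (congrFun hΨ k) k'
  simp only [mul_apply, conjTranspose_apply, RCLike.star_def] at h
  simp only [mul_apply, conjTranspose_apply, pilotMat, of_apply, Fintype.sum_sum_type,
    Fintype.sum_prod_type, ite_and, ite_mul, zero_mul, Finset.sum_ite_irrel, Finset.sum_ite_eq,
    Finset.mem_univ, if_true, Finset.sum_const_zero, add_zero, RCLike.star_def, apply_ite conj,
    map_zero, mul_ite, mul_zero, Complex.conj_ofReal, Complex.conj_conj]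
  simp only [diagonal_apply, Prod.mk.injEq, ite_and, h, one_apply, ← Complex.ofReal_mul,
    ← Complex.ofReal_sum]
  split_ifs with h1 h2
  · rw [pilotVar, h2, Complex.ofReal_add, Complex.ofReal_one, Finset.mul_sum]
    congr 2
    refine Finset.sum_congr rfl fun i _ => ?_
    rw [mul_mul_mul_comm, Real.mul_self_sqrt (by positivity), Real.mul_self_sqrt (hβ _ _)]
  · simp
  · simp

include hβ in
lemma channelMat_mul_conjTranspose (i : Fin L) :
    S.channelMat i * (S.channelMat i)ᴴ
      = diagonal fun p : Fin M × Fin K => (S.β i p.2 : ℂ) := by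
  ext ⟨m, k⟩ ⟨m', k'⟩
  simp only [mul_apply, conjTranspose_apply, channelMat, of_apply, Fintype.sum_sum_type,
    Fintype.sum_prod_type, ite_and, ite_mul, zero_mul, Finset.sum_ite_irrel, Finset.sum_ite_eq,
    Finset.mem_univ, if_true, Finset.sum_const_zero, add_zero, RCLike.star_def, apply_ite conj,
    map_zero, mul_ite, mul_zero, Complex.conj_ofReal]
  simp only [diagonal_apply, Prod.mk.injEq, ite_and, ← Complex.ofReal_mul]
  split_ifs with h1 h2
  · rw [Real.mul_self_sqrt (hβ _ _), h2]
  · rfl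
  · rfl

include hβ in
lemma channelMat_mul_conjTranspose_pilotMat (i : Fin L) :
    S.channelMat i * S.pilotMatᴴ
      = diagonal fun p : Fin M × Fin K => ((√(τ * S.P) * S.β i p.2 : ℝ) : ℂ) := by
  ext ⟨m, k⟩ ⟨m', k'⟩
  simp only [mul_apply, conjTranspose_apply, channelMat, pilotMat, of_apply, Fintype.sum_sum_type,
    Fintype.sum_prod_type, ite_and, ite_mul, zero_mul, Finset.sum_ite_irrel, Finset.sum_ite_eq,
    Finset.mem_univ, if_true, Finset.sum_const_zero, add_zero, RCLike.star_def, apply_ite conj,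
    map_zero, mul_ite, mul_zero, Complex.conj_ofReal]
  simp only [diagonal_apply, Prod.mk.injEq, ite_and, ← Complex.ofReal_mul]
  split_ifs with h1 h2
  · rw [mul_left_comm, Real.mul_self_sqrt (hβ _ _), h2]
  · rfl
  · rfl

lemma pilotMat_mul_conjTranspose_noiseMat :
    S.pilotMat * (noiseMat : Matrix (Fin M) (CoefIdx L K M τ) ℂ)ᴴ = 0 := by
  ext ⟨m, k⟩ m'
  simp [mul_apply, pilotMat, noiseMat, Fintype.sum_sum_type]

lemma noiseMat_mul_conjTranspose :
    (noiseMat : Matrix (Fin M) (CoefIdx L K M τ) ℂ)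
      * (noiseMat : Matrix (Fin M) (CoefIdx L K M τ) ℂ)ᴴ = 1 := by
  ext m m'
  simp [mul_apply, noiseMat, Fintype.sum_sum_type, one_apply]

include hP hβ in
lemma pilotVar_pos (k : Fin K) : 0 < S.pilotVar k := by
  have := Finset.sum_nonneg fun j (_ : j ∈ Finset.univ) => hβ j k
  rw [pilotVar]
  positivity

include hP hβ in
-- The orthogonality principle: `mmseCoef` is the covariance of channel and pilots divided by the
-- pilot variance.
lemma errMat_mul_conjTranspose_pilotMat (hΨ : S.Ψᴴ * S.Ψ = 1) (i : Fin L) :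
    S.errMat i * S.pilotMatᴴ = 0 := by
  rw [errMat, Matrix.sub_mul, Matrix.mul_assoc, pilotMat_mul_conjTranspose hP hβ hΨ,
    channelMat_mul_conjTranspose_pilotMat hβ, diagonal_mul_diagonal, diagonal_sub]
  rw [← diagonal_zero]
  congr 1
  ext p
  have := (pilotVar_pos hP hβ p.2).ne'
  rw [← Complex.ofReal_mul, ← Complex.ofReal_sub, mmseCoef, div_mul_cancel₀ _ this, sub_self,
    Complex.ofReal_zero]

/-- The variance of the estimation error of user `k` of cell `i`. -/
def errVar (S : Uplink L K M τ Ω) (i : Fin L) (k : Fin K) : ℝ :=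
  S.β i k * (τ * S.P * ∑ j ∈ Finset.univ.erase i, S.β j k + 1) / (τ * S.P * ∑ j, S.β j k + 1)

include hP hβ in
lemma errMat_mul_conjTranspose (hΨ : S.Ψᴴ * S.Ψ = 1) (i : Fin L) :
    S.errMat i * (S.errMat i)ᴴ = diagonal fun p : Fin M × Fin K => (S.errVar i p.2 : ℂ) := by
  -- The error is orthogonal to the estimate, so one factor may be replaced by the channel; this
  -- leaves `β - τ P β² / pilotVar`.
  have h : S.errMat i * (S.errMat i)ᴴ = S.errMat i * (S.channelMat i)ᴴ := by
    conv_lhs => rw [errMat, conjTranspose_sub, Matrix.mul_sub, conjTranspose_mul,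
      ← Matrix.mul_assoc, ← errMat, errMat_mul_conjTranspose_pilotMat hP hβ hΨ, Matrix.zero_mul,
      sub_zero]
  have h2 : S.pilotMat * (S.channelMat i)ᴴ
      = diagonal fun p : Fin M × Fin K => ((√(τ * S.P) * S.β i p.2 : ℝ) : ℂ) := by
    have := congrArg conjTranspose (channelMat_mul_conjTranspose_pilotMat hβ i)
    rw [conjTranspose_mul, conjTranspose_conjTranspose, diagonal_conjTranspose] at this
    rw [this]
    congr 1
    ext p
    simp
  rw [h, errMat, Matrix.sub_mul, Matrix.mul_assoc, h2, channelMat_mul_conjTranspose hβ,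
    diagonal_mul_diagonal, diagonal_sub]
  congr 1
  ext p
  have hD := (pilotVar_pos hP hβ p.2).ne'
  have hs : √(τ * S.P) * √(τ * S.P) = τ * S.P := Real.mul_self_sqrt (by positivity)
  rw [← Complex.ofReal_mul, ← Complex.ofReal_sub, mmseCoef, errVar, ← pilotVar]
  congr 1
  have e : √(τ * S.P) * S.β i p.2 / S.pilotVar p.2 * (√(τ * S.P) * S.β i p.2)
      = (√(τ * S.P) * √(τ * S.P)) * S.β i p.2 ^ 2 / S.pilotVar p.2 := by ring
  rw [e, hs, eq_div_iff hD, sub_mul, div_mul_cancel₀ _ hD, pilotVar,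
    ← Finset.add_sum_erase _ _ (Finset.mem_univ i)]
  ring

end Covariance

lemma Ghat_apply {S : Uplink L K M τ Ω} (hP : 0 ≤ S.P) (hβ : ∀ i k, 0 ≤ S.β i k) (i : Fin L)
    (ω : Ω) (m : Fin M) (k : Fin K) : S.Ghat i ω m k = (S.mmseCoef i k : ℂ) * S.Ypt ω m k := by
  rw [Ghat, mul_diagonal, Hhat, of_apply, mul_right_comm, ← Complex.ofReal_mul]
  congr 2
  rw [mul_right_comm, Real.sqrt_mul (by positivity), mul_assoc (√(τ * S.P)),
    Real.mul_self_sqrt (hβ _ _), mmseCoef, pilotVar, div_eq_mul_inv]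

lemma errMat_mulVec {S : Uplink L K M τ Ω} (hP : 0 ≤ S.P) (hβ : ∀ i k, 0 ≤ S.β i k)
    (hΨ : S.Ψᴴ * S.Ψ = 1) (i : Fin L) (ω : Ω) (m : Fin M) (k : Fin K) :
    (S.errMat i *ᵥ fun j => S.gaussians j ω) (m, k) = S.err i ω m k := by
  rw [errMat, sub_mulVec, Pi.sub_apply, channelMat_mulVec, ← mulVec_mulVec, mulVec_diagonal,
    pilotMat_mulVec _ _ _ _ hΨ, err, Matrix.sub_apply, Ghat_apply hP hβ]

/-- Pilot contamination: every estimate is a column scaling of the same projected pilots, so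
estimates of different cells are parallel column by column. -/
lemma Ghat_eq_mul_diagonal {S : Uplink L K M τ Ω} (hP : 0 ≤ S.P) (hβ : ∀ i k, 0 ≤ S.β i k)
    (hβ_pos : ∀ k, 0 < S.β S.ℓ k) (i : Fin L) (ω : Ω) :
    S.Ghat i ω = S.Ghat S.ℓ ω * diagonal fun k => ((S.β i k / S.β S.ℓ k : ℝ) : ℂ) := by
  ext m k
  rw [mul_diagonal, Ghat_apply hP hβ, Ghat_apply hP hβ, mul_right_comm, ← Complex.ofReal_mul]
  congr 2
  have := (hβ_pos k).ne'
  rw [mmseCoef, mmseCoef]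
  field_simp

end Uplink

/-! ### The zero-forcing receiver as a function of the estimate -/

section PinvColumn

variable {m n : Type*} [Fintype m] [Fintype n] [DecidableEq n]

/-- The pseudo-inverse `G (Gᴴ G)⁻¹`, i.e. the zero-forcing receiver for the channel `G`. -/
def zfReceiver (G : Matrix m n ℂ) : Matrix m n ℂ := G * (Gᴴ * G)⁻¹

lemma sum_norm_sq_zfReceiver {G : Matrix m n ℂ} (hG : IsUnit (Gᴴ * G).det) (k : n) :
    ∑ i, ‖zfReceiver G i k‖ ^ 2 = ((Gᴴ * G)⁻¹ k k).re := by
  have h := congrFun (congrFun (conjTranspose_pinv_mul_pinv hG) k) k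
  rw [← h, mul_apply, Complex.re_sum]
  refine Finset.sum_congr rfl fun i _ => ?_
  rw [conjTranspose_apply, RCLike.star_def, ← Complex.normSq_eq_conj_mul_self, Complex.ofReal_re,
    Complex.normSq_eq_norm_sq]
  rfl

lemma measurable_zfReceiver_apply (i : m) (k : n) :
    Measurable fun g : m → n → ℂ => zfReceiver (Matrix.of g) i k := by
  have h : ∀ i j, Measurable fun g : m → n → ℂ => Matrix.of g i j := fun i j => by
    simp only [of_apply]
    fun_prop
  exact measurable_mul_apply h (measurable_matrix_inv_apply (measurable_mul_apply
    (measurable_conjTranspose_apply h) h)) i k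

end PinvColumn

/-! ### Moments and independence in the system model -/

namespace Uplink

variable {L K M τ : ℕ} {Ω : Type*} [MeasurableSpace Ω] {μ : Measure Ω} [IsProbabilityMeasure μ]
  {S : Uplink L K M τ Ω}

namespace IsModel

variable (hS : S.IsModel μ)

include hS in
omit [IsProbabilityMeasure μ] in
-- A user exists, so orthonormal pilots rule out `τ = 0`.
lemma pilots_pos (k : Fin K) : 0 < τ * S.P := by
  have hτ : τ ≠ 0 := by
    rintro rfl
    have := congrFun (congrFun hS.pilots k) k
    simp [mul_apply] at this
  have := hS.P_pos
  positivity

include hS in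
omit [IsProbabilityMeasure μ] in
lemma measurable_gaussians_pi : Measurable fun ω j => S.gaussians j ω :=
  measurable_pi_lambda _ hS.measurable_gaussians

include hS in
lemma map_gaussians :
    μ.map (fun ω j => S.gaussians j ω) = stdComplexGaussianPi (CoefIdx L K M τ) := by
  rw [(iIndepFun_iff_map_fun_eq_pi_map fun j => (hS.measurable_gaussians j).aemeasurable).1
    hS.indep_gaussians]
  congr 1
  ext1 j
  exact hS.law_gaussians j

variable {I I' : Type*} [Fintype I] [Fintype I']

include hS in
omit [Fintype I] in
lemma memLp_mulVec_gaussians (A : Matrix I (CoefIdx L K M τ) ℂ) (i : I) :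
    MemLp (fun ω => (A *ᵥ fun j => S.gaussians j ω) i) 2 μ := by
  have := memLp_mulVec_stdComplexGaussianPi A i
  rw [← hS.map_gaussians] at this
  exact this.comp_of_map hS.measurable_gaussians_pi.aemeasurable

include hS in
omit [Fintype I] in
lemma integral_mulVec_gaussians (A : Matrix I (CoefIdx L K M τ) ℂ) (i : I) :
    ∫ ω, (A *ᵥ fun j => S.gaussians j ω) i ∂μ = 0 := by
  have := integral_mulVec_stdComplexGaussianPi A i
  rw [← hS.map_gaussians, integral_map hS.measurable_gaussians_pi.aemeasurable] at this
  · exact this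
  · rw [hS.map_gaussians]
    exact (memLp_mulVec_stdComplexGaussianPi A i).1

include hS in
omit [Fintype I] [Fintype I'] in
lemma integral_mulVec_gaussians_mul_conj (A : Matrix I (CoefIdx L K M τ) ℂ)
    (B : Matrix I' (CoefIdx L K M τ) ℂ) (i : I) (i' : I') :
    ∫ ω, (A *ᵥ fun j => S.gaussians j ω) i * conj ((B *ᵥ fun j => S.gaussians j ω) i') ∂μ
      = (A * Bᴴ) i i' := by
  have := integral_mulVec_mul_conj_mulVec A B i i'
  rw [← hS.map_gaussians, integral_map hS.measurable_gaussians_pi.aemeasurable] at this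
  · exact this
  · rw [hS.map_gaussians]
    exact (memLp_mulVec_stdComplexGaussianPi A i).1.mul
      (memLp_mulVec_stdComplexGaussianPi B i').conj.1

include hS in
lemma indepFun_mulVec_gaussians (A : Matrix I (CoefIdx L K M τ) ℂ)
    (B : Matrix I' (CoefIdx L K M τ) ℂ) (hAB : A * Bᴴ = 0) :
    IndepFun (fun ω => A *ᵥ fun j => S.gaussians j ω) (fun ω => B *ᵥ fun j => S.gaussians j ω) μ := by
  have h := indepFun_mulVec_stdComplexGaussianPi A B hAB
  have hm := hS.measurable_gaussians_pi
  have hA : Measurable fun z : CoefIdx L K M τ → ℂ => A *ᵥ z := by fun_prop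
  have hB : Measurable fun z : CoefIdx L K M τ → ℂ => B *ᵥ z := by fun_prop
  rw [← hS.map_gaussians, indepFun_iff_map_prod_eq_prod_map_map hA.aemeasurable hB.aemeasurable,
    Measure.map_map (hA.prodMk hB) hm, Measure.map_map hA hm, Measure.map_map hB hm] at h
  exact (indepFun_iff_map_prod_eq_prod_map_map (hA.comp hm).aemeasurable
    (hB.comp hm).aemeasurable).2 h

variable (hβ : ∀ i k, 0 ≤ S.β i k)

include hS hβ in
omit [IsProbabilityMeasure μ] in
lemma err_apply_eq (i : Fin L) (m : Fin M) (k : Fin K) :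
    (fun ω => S.err i ω m k) = fun ω => (S.errMat i *ᵥ fun j => S.gaussians j ω) (m, k) :=
  funext fun ω => (errMat_mulVec hS.P_pos.le hβ hS.pilots i ω m k).symm

include hS hβ in
omit [IsProbabilityMeasure μ] in
lemma measurable_err (i : Fin L) (m : Fin M) (k : Fin K) :
    Measurable fun ω => S.err i ω m k := by
  rw [hS.err_apply_eq hβ]
  have := hS.measurable_gaussians
  simp only [mulVec, dotProduct]
  fun_prop

include hS hβ in
lemma memLp_err (i : Fin L) (m : Fin M) (k : Fin K) : MemLp (fun ω => S.err i ω m k) 2 μ := by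
  rw [hS.err_apply_eq hβ]
  exact hS.memLp_mulVec_gaussians _ _

include hS hβ in
lemma integral_err (i : Fin L) (m : Fin M) (k : Fin K) : ∫ ω, S.err i ω m k ∂μ = 0 := by
  rw [hS.err_apply_eq hβ]
  exact hS.integral_mulVec_gaussians _ _

include hS hβ in
lemma integral_err_mul_conj (i : Fin L) (m m' : Fin M) (k : Fin K) :
    ∫ ω, S.err i ω m k * conj (S.err i ω m' k) ∂μ
      = if m = m' then (S.errVar i k : ℂ) else 0 := by
  have h : ∀ ω, S.err i ω m k * conj (S.err i ω m' k)
      = (S.errMat i *ᵥ fun j => S.gaussians j ω) (m, k)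
        * conj ((S.errMat i *ᵥ fun j => S.gaussians j ω) (m', k)) := fun ω => by
    rw [errMat_mulVec hS.P_pos.le hβ hS.pilots, errMat_mulVec hS.P_pos.le hβ hS.pilots]
  simp_rw [h]
  rw [hS.integral_mulVec_gaussians_mul_conj, errMat_mul_conjTranspose hS.P_pos.le hβ hS.pilots,
    diagonal_apply]
  simp

include hS hβ in
/-- The covariance matrix of the estimation error. -/
theorem integral_err_mul_conjTranspose (i : Fin L) (m m' : Fin M) :
    ∫ ω, (S.err i ω * (S.err i ω)ᴴ) m m' ∂μ
      = if m = m' then ((S.errPower i : ℝ) : ℂ) else 0 := by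
  have hint : ∀ k, Integrable (fun ω => S.err i ω m k * conj (S.err i ω m' k)) μ := fun k =>
    (hS.memLp_err hβ i m k).integrable_mul (hS.memLp_err hβ i m' k).conj
  simp only [mul_apply, conjTranspose_apply, RCLike.star_def]
  rw [integral_finsetSum _ fun k _ => hint k]
  simp_rw [hS.integral_err_mul_conj hβ]
  split_ifs
  · rw [← Complex.ofReal_sum]
    rfl
  · simp

include hS hβ in
omit [IsProbabilityMeasure μ] in
lemma measurable_Ghat (i : Fin L) (m : Fin M) (k : Fin K) :
    Measurable fun ω => S.Ghat i ω m k := by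
  have := hS.measurable_gaussians
  simp_rw [Ghat_apply hS.P_pos.le hβ, ← pilotMat_mulVec S _ _ _ hS.pilots]
  simp only [mulVec, dotProduct]
  fun_prop

/-- The estimate of the channel of the considered cell. -/
def _root_.Uplink.estimate (S : Uplink L K M τ Ω) (ω : Ω) : Fin M → Fin K → ℂ := fun m k => S.Ghat S.ℓ ω m k

include hS hβ in
omit [IsProbabilityMeasure μ] in
lemma measurable_estimate : Measurable (estimate S) :=
  measurable_pi_lambda _ fun m => measurable_pi_lambda _ fun k => hS.measurable_Ghat hβ S.ℓ m k

/-- The estimate as a function of the projected pilots. -/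
def _root_.Uplink.estimateOf (S : Uplink L K M τ Ω) (y : Fin M × Fin K → ℂ) : Fin M → Fin K → ℂ :=
  fun m k => (S.mmseCoef S.ℓ k : ℂ) * y (m, k)

omit [MeasurableSpace Ω] in
lemma measurable_estimateOf : Measurable (estimateOf S) := by
  unfold estimateOf
  fun_prop

include hS hβ in
omit [IsProbabilityMeasure μ] in
lemma estimate_eq (ω : Ω) :
    estimate S ω = estimateOf S (S.pilotMat *ᵥ fun j => S.gaussians j ω) := by
  ext m k
  rw [estimate, estimateOf, Ghat_apply hS.P_pos.le hβ, pilotMat_mulVec _ _ _ _ hS.pilots]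

include hS hβ in
/-- The channel estimate is independent of the noise. -/
lemma indepFun_estimate_noise : IndepFun (estimate S) S.n μ := by
  have h := (hS.indepFun_mulVec_gaussians S.pilotMat noiseMat
    pilotMat_mul_conjTranspose_noiseMat).comp (measurable_estimateOf (S := S)) measurable_id
  have e1 : estimate S = estimateOf S ∘ fun ω => S.pilotMat *ᵥ fun j => S.gaussians j ω :=
    funext fun ω => hS.estimate_eq hβ ω
  have e2 : S.n = id ∘ fun ω => noiseMat *ᵥ fun j => S.gaussians j ω := by
    ext ω m
    exact (noiseMat_mulVec S ω m).symm
  rwa [e1, e2]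

include hS hβ in
/-- The channel estimate is independent of the estimation error and the data of a cell. -/
lemma indepFun_estimate_err_x (i : Fin L) :
    IndepFun (estimate S) (fun ω => ((fun m k => S.err i ω m k : Fin M → Fin K → ℂ), S.x i ω)) μ := by
  have hA : S.pilotMat * (S.errMat i)ᴴ = 0 := by
    rw [← conjTranspose_conjTranspose S.pilotMat, ← conjTranspose_mul,
      errMat_mul_conjTranspose_pilotMat hS.P_pos.le hβ hS.pilots, conjTranspose_zero]
  let φ : (Fin M × Fin K → ℂ) → Fin M → Fin K → ℂ := fun y m k => y (m, k)
  have hφ : Measurable φ := by fun_prop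
  have h := (hS.indepFun_mulVec_gaussians S.pilotMat (S.errMat i) hA).comp
    (measurable_estimateOf (S := S)) hφ
  have e1 : (estimateOf S ∘ fun ω => S.pilotMat *ᵥ fun j => S.gaussians j ω) = estimate S :=
    funext fun ω => (hS.estimate_eq hβ ω).symm
  have e2 : (φ ∘ fun ω => S.errMat i *ᵥ fun j => S.gaussians j ω)
      = fun ω m k => S.err i ω m k := by
    ext ω m k
    exact errMat_mulVec hS.P_pos.le hβ hS.pilots i ω m k
  rw [e1, e2] at h
  have hx : Measurable (S.x i) := measurable_pi_lambda _ fun k => hS.measurable_x i k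
  have he : Measurable fun ω => (fun m k => S.err i ω m k : Fin M → Fin K → ℂ) :=
    measurable_pi_lambda _ fun m => measurable_pi_lambda _ fun k => hS.measurable_err hβ i m k
  refine h.prodMk_right_of_prodMk_left (hS.measurable_estimate hβ) he hx ?_
  -- Estimate and error are jointly a function of the Gaussian coefficients, so the pair is
  -- independent of the data.
  let ψ : (CoefIdx L K M τ → ℂ) → (Fin M → Fin K → ℂ) × (Fin M → Fin K → ℂ) :=
    fun z => (estimateOf S (S.pilotMat *ᵥ z), φ (S.errMat i *ᵥ z))
  have hY : Measurable fun z : CoefIdx L K M τ → ℂ => S.pilotMat *ᵥ z := by fun_prop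
  have hE : Measurable fun z : CoefIdx L K M τ → ℂ => S.errMat i *ᵥ z := by fun_prop
  have hψ : Measurable ψ := ((measurable_estimateOf (S := S)).comp hY).prodMk (hφ.comp hE)
  have h2 := (hS.indep_x.symm.comp hψ (measurable_pi_apply i))
  have e3 : (ψ ∘ fun ω j => S.gaussians j ω)
      = fun ω => (estimate S ω, fun m k => S.err i ω m k) := by
    ext1 ω
    exact Prod.ext (congrFun e1 ω) (congrFun e2 ω)
  rw [e3] at h2
  exact h2

include hS hβ in
omit [IsProbabilityMeasure μ] in
lemma indepFun_err_x (i : Fin L) :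
    IndepFun (fun ω m k => S.err i ω m k) (S.x i) μ := by
  have hψ : Measurable fun (z : CoefIdx L K M τ → ℂ) (m : Fin M) (k : Fin K) =>
      (S.errMat i *ᵥ z) (m, k) := by
    simp only [mulVec, dotProduct]
    fun_prop
  have h := hS.indep_x.symm.comp hψ (measurable_pi_apply i)
  have e : ((fun (z : CoefIdx L K M τ → ℂ) (m : Fin M) (k : Fin K) =>
      (S.errMat i *ᵥ z) (m, k)) ∘ fun ω j => S.gaussians j ω) = fun ω m k => S.err i ω m k := by
    ext ω m k
    exact errMat_mulVec hS.P_pos.le hβ hS.pilots i ω m k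
  rw [e] at h
  exact h

end IsModel

end Uplink

/-! ### The law of the zero-forcing gain and the mean rate -/

namespace Uplink

variable {L K M τ : ℕ} {Ω : Type*} [MeasurableSpace Ω] {μ : Measure Ω} [IsProbabilityMeasure μ]
  {S : Uplink L K M τ Ω}

/-- The standard deviation of the entries of column `k` of the channel estimate. -/
def estimateStd (S : Uplink L K M τ Ω) (k : Fin K) : ℝ := S.mmseCoef S.ℓ k * √(S.pilotVar k)

/-- The projected pilots, normalized to unit variance. -/
def normPilot (S : Uplink L K M τ Ω) (ω : Ω) : Fin M × Fin K → ℂ :=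
  (diagonal (fun p : Fin M × Fin K => (((√(S.pilotVar p.2))⁻¹ : ℝ) : ℂ)) * S.pilotMat) *ᵥ
    fun j => S.gaussians j ω

/-- The diagonal entry of the inverse Gram matrix of the channel estimate. -/
def gramInv (S : Uplink L K M τ Ω) (k : Fin K) (ω : Ω) : ℝ :=
  (((S.Ghat S.ℓ ω)ᴴ * S.Ghat S.ℓ ω)⁻¹ k k).re

namespace IsModel

variable (hS : S.IsModel μ) (hβ : ∀ i k, 0 ≤ S.β i k) (hβ_pos : ∀ k, 0 < S.β S.ℓ k)

include hS in
omit [IsProbabilityMeasure μ] in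
lemma measurable_normPilot : Measurable (normPilot S) := by
  have := hS.measurable_gaussians
  refine measurable_pi_lambda _ fun p => ?_
  simp only [normPilot, mulVec, dotProduct]
  fun_prop

include hS hβ in
-- The pilot covariance is diagonal, so dividing by the standard deviations gives a linear map with
-- orthonormal rows.
lemma map_normPilot : μ.map (normPilot S) = stdComplexGaussianPi (Fin M × Fin K) := by
  set D := diagonal (fun p : Fin M × Fin K => (((√(S.pilotVar p.2))⁻¹ : ℝ) : ℂ))
  have hA : (D * S.pilotMat) * (D * S.pilotMat)ᴴ = 1 := by
    rw [conjTranspose_mul, Matrix.mul_assoc, ← Matrix.mul_assoc S.pilotMat,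
      pilotMat_mul_conjTranspose hS.P_pos.le hβ hS.pilots, diagonal_conjTranspose,
      diagonal_mul_diagonal, diagonal_mul_diagonal, ← diagonal_one]
    congr 1
    ext p
    have hp := pilotVar_pos hS.P_pos.le hβ p.2
    have hs : √(S.pilotVar p.2) ≠ 0 := (Real.sqrt_pos.2 hp).ne'
    rw [Pi.star_apply, RCLike.star_def, Complex.conj_ofReal, ← Complex.ofReal_mul,
      ← Complex.ofReal_mul]
    conv_lhs => rw [← Real.mul_self_sqrt hp.le]
    rw [← Complex.ofReal_one]
    congr 1
    rw [Real.sqrt_mul_self (Real.sqrt_nonneg _)]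
    field_simp
  have h := map_mulVec_stdComplexGaussianPi _ hA
  rw [← hS.map_gaussians, Measure.map_map (by fun_prop) hS.measurable_gaussians_pi] at h
  exact h

include hS hβ in
omit [IsProbabilityMeasure μ] in
lemma Ghat_eq_matrixOf (ω : Ω) : S.Ghat S.ℓ ω
    = matrixOf (normPilot S ω) * diagonal fun k => (estimateStd S k : ℂ) := by
  ext m k
  have hs : √(S.pilotVar k) ≠ 0 := (Real.sqrt_pos.2 (pilotVar_pos hS.P_pos.le hβ k)).ne'
  rw [mul_diagonal, matrixOf, of_apply, normPilot, ← mulVec_mulVec, mulVec_diagonal,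
    pilotMat_mulVec _ _ _ _ hS.pilots, Ghat_apply hS.P_pos.le hβ, mul_right_comm,
    ← Complex.ofReal_mul, estimateStd, mul_left_comm, inv_mul_cancel₀ hs, mul_one]

include hS hβ hβ_pos in
omit [IsProbabilityMeasure μ] in
lemma estimateStd_pos (k : Fin K) : 0 < estimateStd S k := by
  have h1 := pilotVar_pos hS.P_pos.le hβ k
  have h2 := hS.pilots_pos k
  have h3 := hβ_pos k
  rw [estimateStd, mmseCoef]
  positivity

include hS hβ in
omit [IsProbabilityMeasure μ] in
lemma estimateStd_sq (k : Fin K) : estimateStd S k ^ 2 = S.β S.ℓ k ^ 2 / S.betaHat k := by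
  have h1 := pilotVar_pos hS.P_pos.le hβ k
  have h2 := hS.pilots_pos k
  have h3 : S.betaHat k = S.pilotVar k / (τ * S.P) := by
    rw [betaHat, pilotVar, add_div, mul_div_cancel_left₀ _ h2.ne']
  rw [estimateStd, mmseCoef, h3, mul_pow, div_pow, mul_pow, Real.sq_sqrt h2.le, Real.sq_sqrt h1.le]
  field_simp

include hS hβ hβ_pos in
lemma ae_isUnit_det (hKM : K ≤ M) :
    ∀ᵐ ω ∂μ, IsUnit ((S.Ghat S.ℓ ω)ᴴ * S.Ghat S.ℓ ω).det := by
  have h := ae_isUnit_det_gram (m := Fin M) (n := Fin K) (by simpa using hKM)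
  rw [← hS.map_normPilot hβ] at h
  filter_upwards [ae_of_ae_map hS.measurable_normPilot.aemeasurable h] with ω hω
  rw [hS.Ghat_eq_matrixOf hβ]
  exact isUnit_det_gram_mul_diagonal hω _ fun k => (hS.estimateStd_pos hβ hβ_pos k).ne'

include hS hβ hβ_pos in
/-- The zero-forcing gain of a user has an Erlang law. -/
lemma map_gain (hKM : K ≤ M) (k : Fin K) :
    μ.map (fun ω => (estimateStd S k ^ 2 * gramInv S k ω)⁻¹) = erlangMeasure (M - K) := by
  have h := map_inv_gram_inv (m := Fin M) (n := Fin K) (by simpa using hKM) k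
  rw [← hS.map_normPilot hβ, Measure.map_map (measurable_gram_inv_apply k)
    hS.measurable_normPilot, Fintype.card_fin, Fintype.card_fin] at h
  rw [← h]
  congr 1
  ext ω
  have hp := hS.estimateStd_pos hβ hβ_pos k
  rw [gramInv, hS.Ghat_eq_matrixOf hβ,
    gram_inv_mul_diagonal _ _ (fun k => (hS.estimateStd_pos hβ hβ_pos k).ne') k,
    ← Complex.ofReal_pow, Complex.div_ofReal_re, mul_div_cancel₀ _ (by positivity)]
  rfl

include hS hβ in
omit [IsProbabilityMeasure μ] in
lemma measurable_gramInv (k : Fin K) : Measurable (gramInv S k) :=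
  Complex.measurable_re.comp (measurable_matrix_inv_apply (measurable_mul_apply
    (measurable_conjTranspose_apply fun m k => hS.measurable_Ghat hβ S.ℓ m k)
    fun m k => hS.measurable_Ghat hβ S.ℓ m k) k k)

include hS hβ hβ_pos in
/-- The mean rate for given powers of the estimation errors. -/
theorem integral_logb_sinrOf (hKM : K ≤ M) (k : Fin K) (hβ_interf : ∃ i, i ≠ S.ℓ ∧ 0 < S.β i k)
    (α : Fin L → ℝ) (hα : ∀ i, 0 ≤ α i) :
    Integrable (fun ω => Real.logb 2 (1 + S.sinrOf α k ω)) μ ∧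
      ∫ ω, Real.logb 2 (1 + S.sinrOf α k ω) ∂μ
        = rateClosedForm (M - K) (S.aCoef α k) (S.bCoef α k) := by
  have hτP := hS.pilots_pos k
  have hs : 0 < ∑ i, α i + 1 / S.P := by
    have h1 := Finset.sum_nonneg fun i (_ : i ∈ Finset.univ) => hα i
    have h2 := hS.P_pos
    positivity
  have hbh : 0 < S.betaHat k := by
    have h1 := Finset.sum_nonneg fun i (_ : i ∈ Finset.univ) => hβ i k
    rw [betaHat]
    positivity
  -- A positive interferer makes `b > 0`, as the closed form evaluated at `1 / b` requires.
  have hB : 0 < ∑ i ∈ Finset.univ.erase S.ℓ, S.β i k ^ 2 := by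
    obtain ⟨i, hi, hi'⟩ := hβ_interf
    exact Finset.sum_pos' (fun i _ => by positivity) ⟨i, by simp [hi], by positivity⟩
  have hsum : ∑ i, S.β i k ^ 2 = S.β S.ℓ k ^ 2 + ∑ i ∈ Finset.univ.erase S.ℓ, S.β i k ^ 2 :=
    (Finset.add_sum_erase _ _ (Finset.mem_univ _)).symm
  have hl := hβ_pos k
  have ha : 0 < S.aCoef α k := by
    rw [aCoef, hsum]
    positivity
  have hb : 0 < S.bCoef α k := by
    rw [bCoef]
    positivity
  have hmeas : Measurable fun ω => (estimateStd S k ^ 2 * gramInv S k ω)⁻¹ :=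
    ((hS.measurable_gramInv hβ k).const_mul _).inv
  have hlaw := hS.map_gain hβ hβ_pos hKM k
  have hpos : ∀ᵐ x ∂(erlangMeasure (M - K)), x ∉ Set.Iic (0 : ℝ) :=
    measure_eq_zero_iff_ae_notMem.1 (erlangMeasure_Iic_zero _)
  rw [← hlaw] at hpos
  -- With `X` the gain, `q = β̂ / (β_ℓ² X)`; inserting this in the SINR gives `1 + γ = (1 + a X) /
  -- (1 + b X)`. The gain is almost surely positive, which keeps `q` positive.
  have hae : (fun ω => Real.logb 2 (1 + S.sinrOf α k ω)) =ᵐ[μ]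
      (fun x => Real.logb 2 ((1 + S.aCoef α k * x) / (1 + S.bCoef α k * x)))
        ∘ fun ω => (estimateStd S k ^ 2 * gramInv S k ω)⁻¹ := by
    filter_upwards [ae_of_ae_map hmeas.aemeasurable hpos] with ω hω
    simp only [Set.mem_Iic, not_le, inv_pos] at hω
    simp only [Function.comp_apply]
    congr 1
    rw [sinrOf, aCoef, bCoef, hsum, ← gramInv]
    rw [hS.estimateStd_sq hβ] at hω ⊢
    have hq : 0 < gramInv S k ω := (pos_iff_pos_of_mul_pos hω).1 (by positivity)
    generalize gramInv S k ω = q at *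
    generalize ∑ i ∈ Finset.univ.erase S.ℓ, S.β i k ^ 2 = B at *
    generalize ∑ i, α i + 1 / S.P = s at *
    generalize S.betaHat k = β' at *
    generalize S.β S.ℓ k = β₀ at *
    field_simp
    ring
  obtain ⟨h1, h2⟩ := integral_logb_div_erlangMeasure (M - K) ha hb
  rw [← hlaw] at h1 h2
  rw [integral_map hmeas.aemeasurable h1.1] at h2
  refine ⟨(h1.comp_measurable hmeas).congr hae.symm, ?_⟩
  rw [integral_congr_ae hae, ← h2]
  rfl

end IsModel

end Uplink

/-! ### The SINR given the channel estimate -/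

namespace Uplink

variable {L K M τ : ℕ} {Ω : Type*} [MeasurableSpace Ω] {μ : Measure Ω} [IsProbabilityMeasure μ]
  {S : Uplink L K M τ Ω}

omit [MeasurableSpace Ω] in
lemma zf_mulVec_apply (ω : Ω) (v : Fin M → ℂ) (k : Fin K) :
    ((S.zf ω)ᴴ *ᵥ v) k = ∑ m, conj (S.zf ω m k) * v m := rfl

omit [MeasurableSpace Ω] in
lemma sum_norm_sq_zf {ω : Ω} (h : IsUnit ((S.Ghat S.ℓ ω)ᴴ * S.Ghat S.ℓ ω).det) (k : Fin K) :
    ∑ m, ‖S.zf ω m k‖ ^ 2 = gramInv S k ω :=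
  sum_norm_sq_zfReceiver h k

namespace IsModel

variable (hS : S.IsModel μ) (hβ : ∀ i k, 0 ≤ S.β i k) (hβ_pos : ∀ k, 0 < S.β S.ℓ k)

omit [IsProbabilityMeasure μ] in
include hS hβ in
lemma measurable_zf (m : Fin M) (k : Fin K) : Measurable fun ω => S.zf ω m k :=
  (measurable_zfReceiver_apply m k).comp (hS.measurable_estimate hβ)

omit [IsProbabilityMeasure μ] in
include hS hβ in
lemma measurable_err_mulVec (i : Fin L) (m : Fin M) :
    Measurable fun ω => (S.err i ω *ᵥ S.x i ω) m := by
  have h1 := hS.measurable_x i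
  have h2 := hS.measurable_err hβ i
  simp only [mulVec, dotProduct]
  fun_prop

include hS hβ in
lemma memLp_err_mulVec (i : Fin L) (m : Fin M) :
    MemLp (fun ω => (S.err i ω *ᵥ S.x i ω) m) 2 μ :=
  memLp_mulVec_of_indepFun (hS.memLp_err hβ i) (hS.memLp_x i) (hS.indepFun_err_x hβ i) m

include hS hβ in
lemma integral_err_mulVec_mul_conj (i : Fin L) (m m' : Fin M) :
    ∫ ω, (S.err i ω *ᵥ S.x i ω) m * conj ((S.err i ω *ᵥ S.x i ω) m') ∂μ
      = if m = m' then (S.errPower i : ℂ) else 0 := by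
  rw [integral_mulVec_mul_conj_of_indepFun (hS.memLp_err hβ i) (hS.memLp_x i) (hS.cov_x i)
    (hS.integral_err_mul_conj hβ i) (hS.indepFun_err_x hβ i)]
  split_ifs
  · rw [← Complex.ofReal_sum]
    rfl
  · simp

/-- The errors `ξ_i x_i` and the symbol of user `k`. -/
def _root_.Uplink.errAndSymbol (S : Uplink L K M τ Ω) (i : Fin L) (k : Fin K) : Option (Fin M) → Ω → ℂ
  | none => fun ω => S.x i ω k
  | some m => fun ω => (S.err i ω *ᵥ S.x i ω) m

include hS hβ in
/-- The conditional power of `r x_{ik} + a_kᴴ ξ_i x_i`. -/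
lemma condLExp_errAndSymbol (hβ_pos : ∀ k, 0 < S.β S.ℓ k) (hKM : K ≤ M) (i : Fin L) (k : Fin K)
    (r : ℝ) :
    μ⁻[fun ω => ‖r * S.x i ω k + ((S.zf ω)ᴴ *ᵥ (S.err i ω *ᵥ S.x i ω)) k‖ₑ ^ 2 | S.csi]
      =ᵐ[μ] fun ω => ENNReal.ofReal (r ^ 2 + S.errPower i * gramInv S k ω) := by
  -- The index `none` stands for the symbol of user `k`, `some m` for the entry `m` of `ξ_i x_i`;
  -- all coefficients are functions of the estimate.
  let c : Option (Fin M) → (Fin M → Fin K → ℂ) → ℂ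
    | none => fun _ => r
    | some m => fun g => conj (zfReceiver (Matrix.of g) m k)
  let v : Option (Fin M) → ℝ
    | none => 1
    | some _ => S.errPower i
  have hc : ∀ j, Measurable (c j) := by
    rintro (_ | m)
    · exact measurable_const
    · exact Complex.continuous_conj.measurable.comp (measurable_zfReceiver_apply m k)
  have hVm : ∀ j, Measurable (errAndSymbol S i k j) := by
    rintro (_ | m)
    · exact hS.measurable_x i k
    · exact hS.measurable_err_mulVec hβ i m
  have hV : ∀ j, MemLp (errAndSymbol S i k j) 2 μ := by
    rintro (_ | m)
    · exact hS.memLp_x i k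
    · exact hS.memLp_err_mulVec hβ i m
  -- The filtered error and the symbol share the data and need not be independent, but the centered
  -- error makes them uncorrelated, so their powers add.
  have hcross : ∀ m, ∫ ω, (S.err i ω *ᵥ S.x i ω) m * conj (S.x i ω k) ∂μ = 0 := fun m =>
    integral_mulVec_mul_conj_eq_zero (hS.memLp_err hβ i) (hS.memLp_x i) (hS.integral_err hβ i)
      (hS.indepFun_err_x hβ i) m k
  have hcov : ∀ j j', ∫ ω, errAndSymbol S i k j ω * conj (errAndSymbol S i k j' ω) ∂μ
      = if j = j' then (v j : ℂ) else 0 := by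
    rintro (_ | m) (_ | m')
    · simpa [v, errAndSymbol] using hS.cov_x i k k
    · have h : ∀ ω, S.x i ω k * conj ((S.err i ω *ᵥ S.x i ω) m')
          = conj ((S.err i ω *ᵥ S.x i ω) m' * conj (S.x i ω k)) := fun ω => by
        rw [map_mul, Complex.conj_conj, mul_comm]
      simp only [errAndSymbol, h]
      rw [integral_conj, hcross, map_zero, if_neg (by simp)]
    · simp only [errAndSymbol]
      rw [hcross, if_neg (by simp)]
    · simp only [errAndSymbol]
      rw [hS.integral_err_mulVec_mul_conj hβ]
      simp [v]
  have hind : IndepFun (estimate S) (fun ω j => errAndSymbol S i k j ω) μ := by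
    let ψ : (Fin M → Fin K → ℂ) × (Fin K → ℂ) → Option (Fin M) → ℂ := fun p j =>
      match j with
      | none => p.2 k
      | some m => ∑ k', p.1 m k' * p.2 k'
    have hψ : Measurable ψ := by
      refine measurable_pi_lambda _ ?_
      rintro (_ | m)
      · simp only [ψ]
        fun_prop
      · simp only [ψ]
        fun_prop
    have h := (hS.indepFun_estimate_err_x hβ i).comp measurable_id hψ
    have e : (ψ ∘ fun ω => ((fun m k => S.err i ω m k : Fin M → Fin K → ℂ), S.x i ω))
        = fun ω j => errAndSymbol S i k j ω := by
      ext ω j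
      rcases j with _ | m <;> rfl
    rw [e] at h
    exact h
  have key := condLExp_enorm_sq_sum (hS.measurable_estimate hβ) hVm hind hV hcov hc
  have e : (fun ω => ‖∑ j, c j (estimate S ω) * errAndSymbol S i k j ω‖ₑ ^ 2)
      = fun ω => ‖r * S.x i ω k + ((S.zf ω)ᴴ *ᵥ (S.err i ω *ᵥ S.x i ω)) k‖ₑ ^ 2 := by
    ext ω
    rw [Fintype.sum_option, zf_mulVec_apply]
    rfl
  rw [e] at key
  filter_upwards [key, hS.ae_isUnit_det hβ hβ_pos hKM] with ω h1 h2
  refine h1.trans ?_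
  rw [Fintype.sum_option, ← sum_norm_sq_zf h2]
  congr 1
  simp only [c, v, Complex.norm_real, Real.norm_eq_abs, sq_abs, mul_one, RCLike.norm_conj,
    ← Finset.sum_mul]
  rw [mul_comm]
  rfl

include hS hβ in
lemma condLExp_noise (hβ_pos : ∀ k, 0 < S.β S.ℓ k) (hKM : K ≤ M) (k : Fin K) :
    μ⁻[fun ω => ‖((S.zf ω)ᴴ *ᵥ S.n ω) k‖ₑ ^ 2 / ENNReal.ofReal S.P | S.csi]
      =ᵐ[μ] fun ω => ENNReal.ofReal (gramInv S k ω / S.P) := by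
  let c : Fin M → (Fin M → Fin K → ℂ) → ℂ := fun m g => conj (zfReceiver (Matrix.of g) m k)
  have hn : ∀ ω m, (noiseMat *ᵥ fun j => S.gaussians j ω) m = S.n ω m := noiseMat_mulVec S
  have hc : ∀ j, Measurable (c j) := fun m =>
    Complex.continuous_conj.measurable.comp (measurable_zfReceiver_apply m k)
  have hV : ∀ m, MemLp (fun ω => S.n ω m) 2 μ := fun m => by
    simpa only [hn] using hS.memLp_mulVec_gaussians noiseMat m
  have hcov : ∀ m m', ∫ ω, S.n ω m * conj (S.n ω m') ∂μ = if m = m' then ((1 : ℝ) : ℂ) else 0 := by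
    intro m m'
    have := hS.integral_mulVec_gaussians_mul_conj noiseMat noiseMat m m'
    simp only [hn] at this
    rw [this, noiseMat_mul_conjTranspose, one_apply, Complex.ofReal_one]
  have key := condLExp_enorm_sq_sum (V := fun m ω => S.n ω m) (hS.measurable_estimate hβ)
    (fun m => hS.measurable_gaussians (.inr (.inr m)))
    (hS.indepFun_estimate_noise hβ) hV hcov hc
  have e : (fun ω => ‖((S.zf ω)ᴴ *ᵥ S.n ω) k‖ₑ ^ 2 / ENNReal.ofReal S.P)
      = (ENNReal.ofReal S.P)⁻¹ • fun ω => ‖∑ m, c m (estimate S ω) * S.n ω m‖ₑ ^ 2 := by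
    ext ω
    rw [Pi.smul_apply, smul_eq_mul, ENNReal.div_eq_inv_mul]
    rfl
  have hP : (ENNReal.ofReal S.P)⁻¹ ≠ ∞ := by simpa using hS.P_pos
  rw [e]
  filter_upwards [key, condLExp_smul' (P := μ) (mΩ := S.csi)
    (fun ω => ‖∑ m, c m (estimate S ω) * S.n ω m‖ₑ ^ 2) hP,
    hS.ae_isUnit_det hβ hβ_pos hKM] with ω h1 h2 h3
  rw [h2, Pi.smul_apply, smul_eq_mul, ← ENNReal.ofReal_inv_of_pos hS.P_pos]
  refine (congrArg _ h1).trans ?_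
  rw [← ENNReal.ofReal_mul (inv_nonneg.2 hS.P_pos.le), ← sum_norm_sq_zf h3, div_eq_inv_mul]
  congr 2
  simp only [c, RCLike.norm_conj, mul_one]
  rfl

omit [IsProbabilityMeasure μ] in
include hS hβ hβ_pos in
-- Split `G_i = Ĝ_i + ξ_i`. The receiver inverts `Ĝ_ℓ`, and `Ĝ_i` is `Ĝ_ℓ` times a diagonal matrix,
-- so no other symbol of cell `i` passes through the estimated part.
lemma zf_mulVec_G {ω : Ω} (h : IsUnit ((S.Ghat S.ℓ ω)ᴴ * S.Ghat S.ℓ ω).det) (i : Fin L)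
    (k : Fin K) : ((S.zf ω)ᴴ *ᵥ (S.G i ω *ᵥ S.x i ω)) k
      = ((S.β i k / S.β S.ℓ k : ℝ) : ℂ) * S.x i ω k
        + ((S.zf ω)ᴴ *ᵥ (S.err i ω *ᵥ S.x i ω)) k := by
  have h1 : S.G i ω = S.Ghat i ω + S.err i ω := by
    rw [err]
    abel
  rw [h1, add_mulVec, mulVec_add, Pi.add_apply, mulVec_mulVec,
    Ghat_eq_mul_diagonal hS.P_pos.le hβ hβ_pos, ← Matrix.mul_assoc, zf, conjTranspose_pinv_mul h,
    Matrix.one_mul, mulVec_diagonal]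

include hS hβ hβ_pos in
-- The interference power is a sum of squares over cells, so linearity treats each cell alone and
-- the data of different cells may be dependent.
lemma condLExp_interference (hKM : K ≤ M) (k : Fin K) :
    μ⁻[fun ω => ∑ i ∈ Finset.univ.erase S.ℓ, ‖((S.zf ω)ᴴ *ᵥ (S.G i ω *ᵥ S.x i ω)) k‖ₑ ^ 2 | S.csi]
      =ᵐ[μ] fun ω => ∑ i ∈ Finset.univ.erase S.ℓ,
        ENNReal.ofReal ((S.β i k / S.β S.ℓ k) ^ 2 + S.errPower i * gramInv S k ω) := by
  let f : Fin L → Ω → ℝ≥0∞ := fun i ω =>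
    ‖((S.β i k / S.β S.ℓ k : ℝ) : ℂ) * S.x i ω k
      + ((S.zf ω)ᴴ *ᵥ (S.err i ω *ᵥ S.x i ω)) k‖ₑ ^ 2
  have hf : ∀ i, AEMeasurable (f i) μ := by
    intro i
    have h1 := hS.measurable_x i k
    have h2 := fun m => hS.measurable_err_mulVec hβ i m
    have h3 := fun m => Complex.continuous_conj.measurable.comp (hS.measurable_zf hβ m k)
    have h4 : Measurable fun ω => ((S.zf ω)ᴴ *ᵥ (S.err i ω *ᵥ S.x i ω)) k := by
      simp only [zf_mulVec_apply]
      exact Finset.measurable_fun_sum _ fun m _ => (h3 m).mul (h2 m)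
    exact (((measurable_const.mul h1).add h4).enorm.pow_const 2).aemeasurable
  have e : (fun ω => ∑ i ∈ Finset.univ.erase S.ℓ, ‖((S.zf ω)ᴴ *ᵥ (S.G i ω *ᵥ S.x i ω)) k‖ₑ ^ 2)
      =ᵐ[μ] ∑ i ∈ Finset.univ.erase S.ℓ, f i := by
    filter_upwards [hS.ae_isUnit_det hβ hβ_pos hKM] with ω h
    rw [Finset.sum_apply]
    refine Finset.sum_congr rfl fun i _ => ?_
    rw [hS.zf_mulVec_G hβ hβ_pos h]
  refine (condLExp_congr_ae e).trans ((condLExp_finsetSum S.csi _ hf).trans ?_)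
  have h : ∀ᵐ ω ∂μ, ∀ i, μ⁻[f i | S.csi] ω
      = ENNReal.ofReal ((S.β i k / S.β S.ℓ k) ^ 2 + S.errPower i * gramInv S k ω) :=
    ae_all_iff.2 fun i => hS.condLExp_errAndSymbol hβ hβ_pos hKM i k _
  filter_upwards [h] with ω hω
  rw [Finset.sum_apply]
  exact Finset.sum_congr rfl fun i _ => hω i

omit [MeasurableSpace Ω] [IsProbabilityMeasure μ] in
lemma errPower_nonneg (hP : 0 ≤ S.P) (hβ : ∀ i k, 0 ≤ S.β i k) (i : Fin L) :
    0 ≤ S.errPower i := by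
  refine Finset.sum_nonneg fun k _ => ?_
  have h1 := Finset.sum_nonneg fun j (_ : j ∈ Finset.univ) => hβ j k
  have h2 := Finset.sum_nonneg fun j (_ : j ∈ Finset.univ.erase i) => hβ j k
  have h3 := hβ i k
  positivity

omit [MeasurableSpace Ω] [IsProbabilityMeasure μ] in
lemma contamPower_nonneg (hP : 0 ≤ S.P) (hβ : ∀ i k, 0 ≤ S.β i k) (i : Fin L) :
    0 ≤ S.contamPower i := by
  refine Finset.sum_nonneg fun k _ => ?_
  have h1 := Finset.sum_nonneg fun j (_ : j ∈ Finset.univ) => hβ j k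
  have h2 := Finset.sum_nonneg fun j (_ : j ∈ Finset.univ.erase i) => hβ j k
  have h3 := hβ i k
  positivity

include hS hβ hβ_pos in
/-- The SINR as a function of the channel estimate. -/
theorem sinr_ae_eq (hKM : K ≤ M) (k : Fin K) :
    S.sinr μ k =ᵐ[μ] S.sinrOf S.errPower k := by
  -- With `r = 0` only the filtered error remains: the desired symbol is not part of the
  -- disturbance.
  have herr := hS.condLExp_errAndSymbol hβ hβ_pos hKM S.ℓ k 0
  simp only [Complex.ofReal_zero, zero_mul, zero_add, ne_eq, OfNat.ofNat_ne_zero,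
    not_false_eq_true, zero_pow] at herr
  filter_upwards [herr, hS.condLExp_interference hβ hβ_pos hKM k,
    hS.condLExp_noise hβ hβ_pos hKM k, hS.ae_isUnit_det hβ hβ_pos hKM] with ω h1 h2 h3 h4
  have hq : 0 ≤ gramInv S k ω := by
    rw [← sum_norm_sq_zf h4]
    positivity
  have hα := errPower_nonneg hS.P_pos.le hβ
  have hP := hS.P_pos
  have hterm : ∀ i, 0 ≤ (S.β i k / S.β S.ℓ k) ^ 2 + S.errPower i * gramInv S k ω := fun i => by
    have := hα i
    positivity
  have hsum := Finset.sum_nonneg fun i (_ : i ∈ Finset.univ.erase S.ℓ) => hterm i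
  have hℓ := hα S.ℓ
  -- The own error supplies the term `i = ℓ` missing from the interference, completing `∑ i, α_i`.
  rw [sinr, h1, h2, h3, ← ENNReal.ofReal_sum_of_nonneg fun i _ => hterm i,
    ← ENNReal.ofReal_add (by positivity) hsum, ← ENNReal.ofReal_add (by positivity) (by positivity),
    ENNReal.toReal_inv, ENNReal.toReal_ofReal (by positivity), sinrOf, one_div, ← gramInv,
    Finset.sum_add_distrib, ← Finset.add_sum_erase _ S.errPower (Finset.mem_univ S.ℓ),
    ← Finset.sum_mul, Finset.sum_div]
  congr 1
  simp only [div_pow]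
  ring

end IsModel

end Uplink

end

/-! ### Error covariance and both rate formulas -/

theorem proposition3 {L K M τ : ℕ} {Ω : Type*} [MeasurableSpace Ω]
    (μ : Measure Ω) [IsProbabilityMeasure μ] (S : Uplink L K M τ Ω) (hS : S.IsModel μ)
    (hKM : K ≤ M) (k : Fin K)
    (hβ_nonneg : ∀ i k', 0 ≤ S.β i k') (hβ_pos : ∀ k', 0 < S.β S.ℓ k')
    (hβ_interf : ∃ i, i ≠ S.ℓ ∧ 0 < S.β i k) :
    (∀ i m m', ∫ ω, (S.err i ω * (S.err i ω)ᴴ) m m' ∂μ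
        = if m = m' then ((S.errPower i : ℝ) : ℂ) else 0) ∧
    (Integrable (fun ω => Real.logb 2 (1 + S.sinr μ k ω)) μ ∧
      ∫ ω, Real.logb 2 (1 + S.sinr μ k ω) ∂μ
        = rateClosedForm (M - K) (S.aCoef S.errPower k) (S.bCoef S.errPower k)) ∧
    (Integrable (fun ω => Real.logb 2 (1 + S.sinrOf S.contamPower k ω)) μ ∧
      ∫ ω, Real.logb 2 (1 + S.sinrOf S.contamPower k ω) ∂μ
        = rateClosedForm (M - K) (S.aCoef S.contamPower k) (S.bCoef S.contamPower k)) := by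
  refine ⟨fun i m m' => hS.integral_err_mul_conjTranspose hβ_nonneg i m m', ?_,
    hS.integral_logb_sinrOf hβ_nonneg hβ_pos hKM k hβ_interf S.contamPower
      (Uplink.IsModel.contamPower_nonneg hS.P_pos.le hβ_nonneg)⟩
  obtain ⟨h1, h2⟩ := hS.integral_logb_sinrOf hβ_nonneg hβ_pos hKM k hβ_interf S.errPower
    (Uplink.IsModel.errPower_nonneg hS.P_pos.le hβ_nonneg)
  have h : (fun ω => Real.logb 2 (1 + S.sinr μ k ω))
      =ᵐ[μ] fun ω => Real.logb 2 (1 + S.sinrOf S.errPower k ω) := by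
    filter_upwards [hS.sinr_ae_eq hβ_nonneg hβ_pos hKM k] with ω hω
    rw [hω]
  exact ⟨h1.congr h.symm, (integral_congr_ae h).trans h2⟩
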